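/- Let $\psi(x)=\sum_{n\le x}\Lambda(n)$ be the Chebyshev function and $\zeta$ the Riemann zeta-function. For $T\ge 0$ and $u>0$, let $z_1<z_2<\dots<z_n$ be the distinct ordinates of the zeros $s$ of $\zeta$ with $T-u\le \operatorname{Im}(s)\le T+u$, put $z_0=T-u$ and $z_{n+1}=T+u$, and choose $j\in\{1,\dots,n+1\}$ such that $z_j-z_{j-1}\ge z_i-z_{i-1}$ for all $1\le i\le n+1$. The number $T_u=\frac{z_{j-1}+z_j}{2}$ is called an associate of $T$ with respect to $u$ (if several $j$ are possible, any one of them may be chosen). Lemma 9.1 (explicit Landau approximate formula). Let $x\ge x_0=\exp(\exp(15))$ and $\exp(\exp(18))\le T\le x$, and let $T_u$ be an associate of $T$ with respect to $u=1.155$. Then $$\psi(x)=x-\sum_{|\operatorname{Im}(\rho)|\le T_u}\frac{x^\rho}{\rho}+E(x),$$ where the sum runs over the non-trivial zeros $\rho$ of $\zeta$ (those with $0<\operatorname{Re}(\rho)<1$), counted with multiplicity, and $E(x)$ is a real number satisfying $$|E(x)|\le 5.26\,\frac{x\log^2x}{T}+33.488\,\frac{x\log^2T}{T\log x}+3\,\frac{\log^2T}{x}.$$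 -/

import Mathlib

/-- `Tu` is an associate of `T` with respect to `u`: if `z 1 < ⋯ < z n` are the ordinates of the
zeros `s` of the zeta function with `T - u ≤ Im s ≤ T + u`, and `z 0 = T - u`, `z (n + 1) = T + u`,
then `Tu` is the midpoint of a longest one of the intervals `[z j, z (j + 1)]`, `0 ≤ j ≤ n`.
(When several intervals are longest, each of them gives an associate.) -/
def IsAssociate (T u Tu : ℝ) : Prop :=
  ∃ (n : ℕ) (z : ℕ → ℝ),
    z 0 = T - u ∧ z (n + 1) = T + u ∧
    StrictMonoOn z (Set.Icc 1 n) ∧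
    z '' Set.Icc 1 n =
      {y : ℝ | T - u ≤ y ∧ y ≤ T + u ∧ ∃ s : ℂ, riemannZeta s = 0 ∧ s.im = y} ∧
    ∃ j ≤ n, (∀ i ≤ n, z (i + 1) - z i ≤ z (j + 1) - z j) ∧ Tu = (z j + z (j + 1)) / 2

/-- The set of non-trivial zeros `ρ` of the zeta function with `|Im ρ| ≤ H`. -/
def nontrivialZerosUpTo (H : ℝ) : Set ℂ :=
  {ρ : ℂ | riemannZeta ρ = 0 ∧ 0 < ρ.re ∧ ρ.re < 1 ∧ |ρ.im| ≤ H}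

theorem nontrivialZerosUpTo_finite (H : ℝ) : (nontrivialZerosUpTo H).Finite := by
  have hc : IsCompact (Set.Icc (0 : ℝ) 1 ×ℂ Set.Icc (-H) H) := isCompact_Icc.reProdIm isCompact_Icc
  refine hc.inter_riemannZetaZeros_finite.subset ?_
  rintro ρ ⟨h0, h1, h2, h3⟩
  exact ⟨⟨⟨h1.le, h2.le⟩, abs_le.mp h3⟩, h0⟩

/-- The sum of `x ^ ρ / ρ` over the non-trivial zeros `ρ` of the zeta function with `|Im ρ| ≤ H`,
each zero being counted with its multiplicity. -/
noncomputable def zeroSum (x H : ℝ) : ℂ :=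
  ∑ ρ ∈ (nontrivialZerosUpTo_finite H).toFinset,
    (analyticOrderNatAt riemannZeta ρ : ℂ) * ((x : ℂ) ^ ρ / ρ)

/-!
The proof is the truncated Perron formula. With `c = 1 + 1 / log x`, the integral of
`-ζ'/ζ(s) x ^ s / s` over the segment from `c - i H` to `c + i H`, where `H` is the associate, is
evaluated in two ways.

On the one hand, expanding `-ζ'/ζ` into its Dirichlet series gives `ψ(x)` up to the errors of the
truncated kernel at `x / n` (`norm_tsum_perronKernel_sub_psi_le`). The integers `n` near `x` are the
expensive ones: the kernel decays like `1 / (H |log (x / n)|)`, and the resulting harmonic sums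
contribute `8.4 / π < 2.71` times `x log² x / T`. For the two integers next to `x` the
kernel is only `O(log H)`, which costs `1.4 log² x ≤ 1.4 x log² x / T`. All remaining contributions
are of smaller order in `log x`, hence negligible for `log x ≥ 10 ^ 7`, and the total stays below
`5.26 x log² x / T` (`error_terms_le`). The other two terms of the stated bound are not needed.

On the other hand, Cauchy's theorem for the rectangle with left side on `re s = -1 / 4` gives the
residues `x`, `-x ^ ρ / ρ` and `-log (2 π)` (`rectIntegral_neg_logDeriv_riemannZeta`), and what
remains is a bound for `ζ'/ζ` on the other three sides. It comes from the growth of the entire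
function `(s - 1) ζ(s)`, which is `riemannZeta₁` in Mathlib: the trapezoidal rule shows that it is
`O(|s| ^ 3)` for `re s ≥ -3 / 4` (`norm_riemannZeta₁_le`). Dividing out its zeros near `2 + t i`
by Blaschke factors, and applying the Borel–Carathéodory theorem to the quotient, bounds both the
number of these zeros and the difference between the logarithmic derivative and its principal
parts by multiples of `log t` (`zero_count_and_logDeriv_bound`, `nearbyZeros_bounds`). Since there
are at most `O(log T)` ordinates around `T`, the longest gap between them has length at least a
constant over `log T`, so that on the line `im s = H` no zero is nearer than that
(`IsAssociate.gap`). Hence `ζ'/ζ` is `O(log² T)` on the horizontal sides, which after integration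
against `x ^ σ / H` gives `O(x log² T / (T log x))`.
-/

open Complex Metric ComplexConjugate

/-! ### Zeros and logarithmic derivatives of entire functions -/

theorem analyticOrderAt_ne_top_of_entire {f : ℂ → ℂ} (hf : Differentiable ℂ f)
    (hne : ∃ z, f z ≠ 0) (a : ℂ) : analyticOrderAt f a ≠ ⊤ := by
  intro h
  obtain ⟨z, hz⟩ := hne
  have han : AnalyticOnNhd ℂ f Set.univ := fun z _ => hf.analyticAt z
  exact hz (han.eqOn_zero_of_preconnected_of_eventuallyEq_zero isPreconnected_univ
    (Set.mem_univ a) (analyticOrderAt_eq_top.mp h) (Set.mem_univ z))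

theorem exists_entire_eq_pow_mul {f : ℂ → ℂ} (hf : Differentiable ℂ f)
    (hne : ∃ z, f z ≠ 0) (a : ℂ) :
    ∃ g : ℂ → ℂ, Differentiable ℂ g ∧ g a ≠ 0 ∧
      ∀ z, f z = (z - a) ^ analyticOrderNatAt f a * g z := by
  obtain ⟨G, hG, hGa, hfG⟩ :=
    (hf.analyticAt a).analyticOrderAt_ne_top.mp (analyticOrderAt_ne_top_of_entire hf hne a)
  set n := analyticOrderNatAt f a
  let g : ℂ → ℂ := fun z => if z = a then G a else f z / (z - a) ^ n
  have hgG : g =ᶠ[nhds a] G := by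
    filter_upwards [hfG] with z hz
    by_cases h : z = a
    · simp [g, h]
    · have : (z - a) ^ n ≠ 0 := pow_ne_zero _ (sub_ne_zero.mpr h)
      simp only [g, h, if_false, hz, smul_eq_mul]
      field_simp
  refine ⟨g, fun z => ?_, by simpa [g] using hGa, fun z => ?_⟩
  · by_cases h : z = a
    · subst h
      exact (hG.differentiableAt).congr_of_eventuallyEq hgG
    · have h1 : g =ᶠ[nhds z] fun z => f z / (z - a) ^ n := by
        filter_upwards [isOpen_ne.mem_nhds h] with w hw
        simp only [g]
        rw [if_neg hw]
      refine DifferentiableAt.congr_of_eventuallyEq ?_ h1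
      exact (hf z).div (by fun_prop) (pow_ne_zero _ (sub_ne_zero.mpr h))
  · by_cases h : z = a
    · subst h
      simpa [g] using hfG.self_of_nhds
    · have : (z - a) ^ n ≠ 0 := pow_ne_zero _ (sub_ne_zero.mpr h)
      simp only [g, h, if_false]
      field_simp

/-- An entire function is a polynomial carrying its zeros in a given finite set, with their
multiplicities, times an entire function without zeros in this set. -/
theorem exists_entire_eq_prod_mul {f : ℂ → ℂ} (hf : Differentiable ℂ f)
    (hne : ∃ z, f z ≠ 0) (S : Finset ℂ) :
    ∃ g : ℂ → ℂ, Differentiable ℂ g ∧ (∀ ρ ∈ S, g ρ ≠ 0) ∧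
      ∀ z, f z = (∏ ρ ∈ S, (z - ρ) ^ analyticOrderNatAt f ρ) * g z := by
  induction S using Finset.induction_on with
  | empty => exact ⟨f, hf, by simp, by simp⟩
  | insert a S ha ih =>
    obtain ⟨g, hg, hgS, hfg⟩ := ih
    have hgne : ∃ z, g z ≠ 0 := by
      obtain ⟨z, hz⟩ := hne
      exact ⟨z, fun h => hz (by rw [hfg, h, mul_zero])⟩
    obtain ⟨k, hk, hka, hgk⟩ := exists_entire_eq_pow_mul hg hgne a
    have hord : analyticOrderNatAt f a = analyticOrderNatAt g a := by
      have hP : Differentiable ℂ fun z => ∏ ρ ∈ S, (z - ρ) ^ analyticOrderNatAt f ρ := by fun_prop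
      have h1 : f = (fun z => ∏ ρ ∈ S, (z - ρ) ^ analyticOrderNatAt f ρ) * g := funext hfg
      have h2 : analyticOrderAt (fun z => ∏ ρ ∈ S, (z - ρ) ^ analyticOrderNatAt f ρ) a = 0 := by
        rw [(hP.analyticAt a).analyticOrderAt_eq_zero, Finset.prod_ne_zero_iff]
        intro ρ hρ
        exact pow_ne_zero _ (sub_ne_zero.mpr fun h => ha (h ▸ hρ))
      unfold analyticOrderNatAt
      conv_lhs => rw [h1]
      rw [analyticOrderAt_mul (hP.analyticAt a) (hg.analyticAt a), h2, zero_add]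
    refine ⟨k, hk, ?_, fun z => ?_⟩
    · intro ρ hρ
      rcases Finset.mem_insert.mp hρ with rfl | h
      · exact hka
      · intro h0
        exact hgS ρ h (by rw [hgk, h0, mul_zero])
    · rw [Finset.prod_insert ha, hfg z, hgk z, hord]
      ring

theorem logDeriv_eq_sum_add_logDeriv {f g : ℂ → ℂ} (hg : Differentiable ℂ g) {S : Finset ℂ}
    {m : ℂ → ℕ} (hfg : ∀ z, f z = (∏ ρ ∈ S, (z - ρ) ^ m ρ) * g z)
    {s : ℂ} (hS : ∀ ρ ∈ S, s ≠ ρ) (hgs : g s ≠ 0) :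
    logDeriv f s = ∑ ρ ∈ S, (m ρ : ℂ) / (s - ρ) + logDeriv g s := by
  have h1 : f = fun z => (∏ ρ ∈ S, (z - ρ) ^ m ρ) * g z := funext hfg
  have h0 : ∀ ρ ∈ S, (s - ρ) ^ m ρ ≠ 0 := fun ρ hρ => pow_ne_zero _ (sub_ne_zero.mpr (hS ρ hρ))
  rw [h1, logDeriv_mul s (Finset.prod_ne_zero_iff.mpr h0) hgs (by fun_prop) (hg s)]
  congr 1
  rw [logDeriv_prod h0 (fun ρ _ => by fun_prop)]
  refine Finset.sum_congr rfl fun ρ hρ => ?_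
  rw [logDeriv_fun_pow (f := fun z => z - ρ) (by fun_prop)]
  simp [logDeriv_apply, div_eq_mul_inv]

/-- Borel–Carathéodory for logarithmic derivatives. -/
theorem norm_logDeriv_le_of_norm_le {G : ℂ → ℂ} (hG : Differentiable ℂ G) {c : ℂ} {r R M : ℝ}
    (hr : 0 ≤ r) (hrR : r < R) (hM : 1 < M) (hne : ∀ z ∈ ball c R, G z ≠ 0)
    (hb : ∀ z ∈ ball c R, ‖G z‖ ≤ M * ‖G c‖) {s : ℂ} (hs : s ∈ closedBall c r) :
    ‖logDeriv G s‖ ≤ 8 * R / (R - r) ^ 2 * Real.log M := by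
  have hR : 0 < R := hr.trans_lt hrR
  have hc : c ∈ ball c R := mem_ball_self hR
  have hdiff : DifferentiableOn ℂ (logDeriv G) (ball c R) := by
    intro z hz
    have : DifferentiableAt ℂ (fun z => deriv G z / G z) z :=
      (hG.deriv z).div (hG z) (hne z hz)
    exact this.differentiableWithinAt
  obtain ⟨h, hh0, hh⟩ : ∃ h : ℂ → ℂ, h c = 0 ∧ ∀ z ∈ ball c R, HasDerivAt h (logDeriv G z) z := by
    obtain ⟨h, hh⟩ := hdiff.isExactOn_ball.with_val_at c 0
    exact ⟨h, hh.1, hh.2⟩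
  have hexp : ∀ z ∈ ball c R, G z = G c * exp (h z) := by
    have hd : ∀ z ∈ ball c R, HasDerivAt (fun z => G z * exp (-h z)) 0 z := by
      intro z hz
      have h1 := (hG z).hasDerivAt.mul ((hh z hz).neg.cexp)
      refine h1.congr_deriv ?_
      rw [logDeriv_apply]
      have := hne z hz
      simp only [Pi.neg_apply]
      field_simp
      ring
    intro z hz
    have hconst := (convex_ball c R).is_const_of_fderivWithin_eq_zero (𝕜 := ℂ)
      (f := fun z => G z * exp (-h z))
      (fun z hz => (hd z hz).differentiableAt.differentiableWithinAt) (fun z hz => by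
        rw [fderivWithin_of_isOpen isOpen_ball hz]
        ext
        simp [(hd z hz).hasFDerivAt.fderiv]) hz hc
    simp only [hh0, neg_zero, exp_zero, mul_one] at hconst
    rw [← hconst, mul_assoc, ← exp_add]
    simp
  have hre : ∀ z ∈ ball c R, (h z).re ≤ Real.log M := by
    intro z hz
    have h1 := hb z hz
    rw [hexp z hz, norm_mul, norm_exp, mul_comm] at h1
    have h2 := le_of_mul_le_mul_right h1 (norm_pos_iff.mpr (hne c hc))
    exact (Real.le_log_iff_exp_le (by linarith)).mpr h2
  have hlogM : 0 < Real.log M := Real.log_pos hM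
  set r' := (r + R) / 2 with hr'
  have hbc : ∀ z ∈ ball c R, ‖z - c‖ ≤ r' → ‖h z‖ ≤ 2 * Real.log M * R / ((R - r) / 2) := by
    intro z hz hzr
    have := Complex.borelCaratheodory_zero (f := fun w => h (c + w)) (R := R) (z := z - c) hlogM
      (by
        intro w hw
        have hw' : c + w ∈ ball c R := by simpa [mem_ball, dist_eq] using hw
        have h1 := (hh _ hw').differentiableAt
        exact (h1.comp w (by fun_prop)).differentiableWithinAt)
      (by
        intro w hw
        have hw' : c + w ∈ ball c R := by simpa [mem_ball, dist_eq] using hw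
        exact hre _ hw') hR (by simpa [mem_ball, dist_eq] using hz) (by simpa using hh0)
    simp only [add_sub_cancel] at this
    refine this.trans ?_
    gcongr
    · linarith
    · linarith
  have hsub : closedBall s ((R - r) / 2) ⊆ closedBall c r' := by
    apply closedBall_subset_closedBall'
    rw [mem_closedBall] at hs
    rw [hr']; linarith
  have hsub' : closedBall c r' ⊆ ball c R := closedBall_subset_ball (by rw [hr']; linarith)
  have hs' : s ∈ ball c R := mem_ball.mpr ((mem_closedBall.mp hs).trans_lt hrR)
  have := Complex.norm_deriv_le_of_forall_mem_sphere_norm_le (f := h) (c := s)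
    (R := (R - r) / 2) (C := 2 * Real.log M * R / ((R - r) / 2)) (by linarith)
    (by
      apply DifferentiableOn.diffContOnCl
      rw [closure_ball _ (by linarith)]
      exact fun z hz => (hh z (hsub' (hsub hz))).differentiableAt.differentiableWithinAt)
    (by
      intro z hz
      have hz1 := hsub (sphere_subset_closedBall hz)
      exact hbc z (hsub' hz1) (by simpa [dist_eq] using hz1))
  rw [(hh s hs').deriv] at this
  refine this.trans (le_of_eq ?_)
  have : R - r ≠ 0 := by linarith
  field_simp
  norm_num

theorem norm_sq_sub_conj_mul {R : ℝ} {w : ℂ} (hw : ‖w‖ = R) (a : ℂ) :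
    ‖(R : ℂ) ^ 2 - conj a * w‖ = R * ‖w - a‖ := by
  have : (R : ℂ) ^ 2 = conj w * w := by
    rw [← hw, mul_comm, mul_conj, normSq_eq_norm_sq]; push_cast; rfl
  rw [this, ← sub_mul, ← map_sub, norm_mul, norm_conj, hw, mul_comm]

/-- Dividing the zeros in a disc of radius `r` out of `f` by Blaschke factors of a larger disc of
radius `R` gives a function which obeys the same bound as `f`, has no zeros in the small disc, and
is larger at the centre by a factor `R / r` for every zero. -/
theorem exists_blaschke_quotient {f : ℂ → ℂ} (hf : Differentiable ℂ f) {c : ℂ} {r R B : ℝ}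
    (hr : 0 < r) (hrR : r < R) (hc : f c ≠ 0)
    (hb : ∀ z ∈ sphere c R, ‖f z‖ ≤ B) (S : Finset ℂ)
    (hS : ∀ ρ ∈ S, ρ ∈ closedBall c r) (hSz : ∀ ρ ∈ S, f ρ = 0)
    (hzero : ∀ z ∈ closedBall c r, f z = 0 → z ∈ S) :
    ∃ G : ℂ → ℂ, Differentiable ℂ G ∧ (∀ z ∈ closedBall c r, G z ≠ 0) ∧
      (∀ z ∈ closedBall c R, ‖G z‖ ≤ B) ∧
      (R / r) ^ (∑ ρ ∈ S, analyticOrderNatAt f ρ) * ‖f c‖ ≤ ‖G c‖ ∧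
      ∀ s ∈ closedBall c r, f s ≠ 0 →
        ‖logDeriv f s - ∑ ρ ∈ S, (analyticOrderNatAt f ρ : ℂ) / (s - ρ)‖ ≤
          ‖logDeriv G s‖ + (∑ ρ ∈ S, analyticOrderNatAt f ρ : ℕ) * (r / (R ^ 2 - r ^ 2)) := by
  obtain ⟨g, hg, hgS, hfg⟩ := exists_entire_eq_prod_mul hf ⟨c, hc⟩ S
  set m : ℂ → ℕ := analyticOrderNatAt f
  have hR : 0 < R := hr.trans hrR
  let b : ℂ → ℂ → ℂ := fun ρ z => ((R : ℂ) ^ 2 - conj (ρ - c) * (z - c)) / R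
  have hbd : ∀ ρ, Differentiable ℂ (b ρ) := fun ρ => by simp only [b]; fun_prop
  have hRr : 0 < R ^ 2 - r ^ 2 := by nlinarith
  have hlow : ∀ ρ ∈ S, ∀ z ∈ closedBall c r,
      R ^ 2 - r ^ 2 ≤ ‖(R : ℂ) ^ 2 - conj (ρ - c) * (z - c)‖ := by
    intro ρ hρ z hz
    have h1 : ‖ρ - c‖ ≤ r := by simpa [dist_eq] using hS ρ hρ
    have h2 : ‖z - c‖ ≤ r := by simpa [dist_eq] using hz
    have h3 := norm_sub_norm_le ((R : ℂ) ^ 2) (conj (ρ - c) * (z - c))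
    rw [norm_mul, norm_conj, norm_pow, norm_real, Real.norm_of_nonneg hR.le] at h3
    nlinarith [mul_le_mul h1 h2 (norm_nonneg _) hr.le]
  have hbne : ∀ ρ ∈ S, ∀ z ∈ closedBall c r, b ρ z ≠ 0 := by
    intro ρ hρ z hz h0
    have := hlow ρ hρ z hz
    rcases div_eq_zero_iff.mp h0 with h | h
    · rw [h, norm_zero] at this; linarith
    · exact hR.ne' (by exact_mod_cast h)
  have hgne : ∀ z ∈ closedBall c r, g z ≠ 0 := by
    intro z hz h0
    by_cases hzS : z ∈ S
    · exact hgS z hzS h0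
    · exact hzS (hzero z hz (by rw [hfg, h0, mul_zero]))
  let G : ℂ → ℂ := fun z => (∏ ρ ∈ S, b ρ z ^ m ρ) * g z
  have hG : Differentiable ℂ G := by
    have : Differentiable ℂ fun z => ∏ ρ ∈ S, b ρ z ^ m ρ :=
      Differentiable.fun_finsetProd fun ρ _ => (hbd ρ).pow _
    exact this.mul hg
  refine ⟨G, hG, ?_, ?_, ?_, ?_⟩
  · intro z hz
    exact mul_ne_zero (Finset.prod_ne_zero_iff.mpr fun ρ hρ => pow_ne_zero _ (hbne ρ hρ z hz))
      (hgne z hz)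
  · have hsph : ∀ z ∈ frontier (ball c R), ‖G z‖ ≤ B := by
      intro z hz
      rw [frontier_ball _ hR.ne'] at hz
      have hzR : ‖z - c‖ = R := by simpa [dist_eq] using hz
      refine le_trans (le_of_eq ?_) (hb z hz)
      rw [hfg z]
      simp only [G, norm_mul, norm_prod, norm_pow, b, norm_div]
      congr 1
      refine Finset.prod_congr rfl fun ρ _ => ?_
      rw [norm_sq_sub_conj_mul hzR, norm_real, Real.norm_of_nonneg hR.le,
        mul_div_cancel_left₀ _ hR.ne', sub_sub_sub_cancel_right]
    intro z hz
    refine Complex.norm_le_of_forall_mem_frontier_norm_le isBounded_ball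
      hG.diffContOnCl hsph ?_
    rwa [closure_ball _ hR.ne']
  · rw [hfg c]
    simp only [G, norm_mul, norm_prod, norm_pow, b, sub_self, mul_zero, sub_zero, norm_div]
    rw [← mul_assoc, ← Finset.prod_pow_eq_pow_sum, ← Finset.prod_mul_distrib]
    refine mul_le_mul_of_nonneg_right ?_ (norm_nonneg _)
    refine Finset.prod_le_prod (fun ρ _ => by positivity) fun ρ hρ => ?_
    rw [← mul_pow]
    refine pow_le_pow_left₀ (by positivity) ?_ _
    have h1 : ‖c - ρ‖ ≤ r := by rw [norm_sub_rev]; simpa [dist_eq] using hS ρ hρ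
    rw [norm_real, Real.norm_of_nonneg hR.le, pow_two, mul_div_cancel_right₀ _ hR.ne',
      div_mul_eq_mul_div, div_le_iff₀ hr]
    gcongr
  · intro s hs hfs
    have hsS : ∀ ρ ∈ S, s ≠ ρ := by
      rintro ρ hρ rfl
      exact hfs (hSz s hρ)
    have e1 := logDeriv_eq_sum_add_logDeriv hg hfg hsS (hgne s hs)
    have e2 : logDeriv G s = ∑ ρ ∈ S, (m ρ : ℂ) * logDeriv (b ρ) s + logDeriv g s := by
      have h0 : ∀ ρ ∈ S, b ρ s ^ m ρ ≠ 0 := fun ρ hρ => pow_ne_zero _ (hbne ρ hρ s hs)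
      have hd : ∀ ρ ∈ S, DifferentiableAt ℂ (fun z => b ρ z ^ m ρ) s :=
        fun ρ _ => ((hbd ρ).pow _) s
      simp only [G]
      rw [logDeriv_mul s (Finset.prod_ne_zero_iff.mpr h0) (hgne s hs)
        (DifferentiableAt.fun_finsetProd hd) (hg s), logDeriv_prod h0 hd]
      congr 1
      refine Finset.sum_congr rfl fun ρ hρ => ?_
      rw [logDeriv_fun_pow (hbd ρ s)]
    have e3 : logDeriv f s - ∑ ρ ∈ S, (m ρ : ℂ) / (s - ρ) =
        logDeriv G s - ∑ ρ ∈ S, (m ρ : ℂ) * logDeriv (b ρ) s := by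
      rw [e1, e2]; ring
    rw [e3]
    refine (norm_sub_le _ _).trans (add_le_add le_rfl ?_)
    refine (norm_sum_le _ _).trans ?_
    push_cast
    rw [Finset.sum_mul]
    refine Finset.sum_le_sum fun ρ hρ => ?_
    rw [norm_mul, Complex.norm_natCast]
    refine mul_le_mul_of_nonneg_left ?_ (Nat.cast_nonneg _)
    have hder : HasDerivAt (b ρ) (-conj (ρ - c) / R) s := by
      have h1 : HasDerivAt (fun z : ℂ => (R : ℂ) ^ 2 - conj (ρ - c) * (z - c))
        (-conj (ρ - c)) s := by
        simpa using (((hasDerivAt_id s).sub_const c).const_mul (conj (ρ - c))).const_sub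
          ((R : ℂ) ^ 2)
      exact h1.div_const _
    rw [logDeriv_apply, hder.deriv]
    simp only [b]
    rw [div_div_div_cancel_right₀ (by exact_mod_cast hR.ne'), norm_div, norm_neg, norm_conj]
    have h1 : ‖ρ - c‖ ≤ r := by simpa [dist_eq] using hS ρ hρ
    exact div_le_div₀ hr.le h1 hRr (hlow ρ hρ s hs)

/-- The zeros of an entire function in a disc are controlled by its growth on a larger circle, and
near the centre the logarithmic derivative is close to the sum of its principal parts. -/
theorem zero_count_and_logDeriv_bound {f : ℂ → ℂ} (hf : Differentiable ℂ f) {c : ℂ}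
    {r₀ r R M : ℝ} (hr₀ : 0 ≤ r₀) (hr₀r : r₀ < r) (hrR : r < R) (hM : 1 < M) (hc : f c ≠ 0)
    (hb : ∀ z ∈ sphere c R, ‖f z‖ ≤ M * ‖f c‖) (S : Finset ℂ)
    (hS : ∀ ρ ∈ S, ρ ∈ closedBall c r) (hSz : ∀ ρ ∈ S, f ρ = 0)
    (hzero : ∀ z ∈ closedBall c r, f z = 0 → z ∈ S) :
    (R / r) ^ (∑ ρ ∈ S, analyticOrderNatAt f ρ) ≤ M ∧
      ∀ s ∈ closedBall c r₀, f s ≠ 0 →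
        ‖logDeriv f s - ∑ ρ ∈ S, (analyticOrderNatAt f ρ : ℂ) / (s - ρ)‖ ≤
          8 * r / (r - r₀) ^ 2 * Real.log M +
            (∑ ρ ∈ S, analyticOrderNatAt f ρ : ℕ) * (r / (R ^ 2 - r ^ 2)) := by
  have hr : 0 < r := hr₀.trans_lt hr₀r
  obtain ⟨G, hG, hGne, hGb, hGc, hGd⟩ := exists_blaschke_quotient hf hr hrR hc hb S hS hSz hzero
  have hfc : 0 < ‖f c‖ := norm_pos_iff.mpr hc
  have hcR : c ∈ closedBall c R := mem_closedBall_self (hr.trans hrR).le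
  have hfG : ‖f c‖ ≤ ‖G c‖ := by
    refine le_trans ?_ hGc
    exact le_mul_of_one_le_left hfc.le (one_le_pow₀ ((one_le_div hr).mpr hrR.le))
  refine ⟨le_of_mul_le_mul_right (hGc.trans (hGb c hcR)) hfc, fun s hs hfs => ?_⟩
  refine (hGd s (closedBall_subset_closedBall hr₀r.le hs) hfs).trans ?_
  gcongr
  refine norm_logDeriv_le_of_norm_le hG hr₀ hr₀r hM
    (fun z hz => hGne z (ball_subset_closedBall hz)) (fun z hz => ?_) hs
  refine (hGb z (closedBall_subset_closedBall hrR.le (ball_subset_closedBall hz))).trans ?_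
  gcongr

/-! ### Growth of the zeta function -/

/-- The error of the trapezoidal rule for `∫ x ^ (-s)` over `[n + 1, n + 2]`, multiplied by
`s - 1` to remove the pole at `s = 1`. -/
noncomputable def trapezoidTerm (n : ℕ) (s : ℂ) : ℂ :=
  (s - 1) / 2 * ((n + 1 : ℂ) ^ (-s) + (n + 2 : ℂ) ^ (-s)) +
    ((n + 2 : ℂ) ^ (1 - s) - (n + 1 : ℂ) ^ (1 - s))

theorem differentiable_trapezoidTerm (n : ℕ) : Differentiable ℂ (trapezoidTerm n) := by
  have h1 : (n + 1 : ℂ) ≠ 0 := by exact_mod_cast n.succ_ne_zero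
  have h2 : (n + 2 : ℂ) ≠ 0 := by exact_mod_cast (n + 1).succ_ne_zero
  intro s
  unfold trapezoidTerm
  have a1 : DifferentiableAt ℂ (fun s : ℂ => (n + 1 : ℂ) ^ (-s)) s :=
    DifferentiableAt.const_cpow (by fun_prop) (Or.inl h1)
  have a2 : DifferentiableAt ℂ (fun s : ℂ => (n + 2 : ℂ) ^ (-s)) s :=
    DifferentiableAt.const_cpow (by fun_prop) (Or.inl h2)
  have a3 : DifferentiableAt ℂ (fun s : ℂ => (n + 1 : ℂ) ^ (1 - s)) s :=
    DifferentiableAt.const_cpow (by fun_prop) (Or.inl h1)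
  have a4 : DifferentiableAt ℂ (fun s : ℂ => (n + 2 : ℂ) ^ (1 - s)) s :=
    DifferentiableAt.const_cpow (by fun_prop) (Or.inl h2)
  fun_prop

/-- The error of the trapezoidal rule is a second-order quantity; this makes the series of the
terms converge in a half-plane which contains the critical strip. -/
theorem norm_trapezoidTerm_le (n : ℕ) {s : ℂ} (hs : -(3 / 4) ≤ s.re) :
    ‖trapezoidTerm n s‖ ≤
      ‖s - 1‖ * ‖s‖ * ‖s + 1‖ / 8 * (1 / (n + 1 : ℝ) ^ (5 / 4 : ℝ)) := by
  -- The trapezoidal error is `∫ u in 0..1, u (1 - u) / 2 * f'' (n + 1 + u)`; the function `K` is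
  -- an explicit primitive of this integrand.
  let K : ℝ → ℂ := fun u =>
    (s - 1) * (u * (1 - u)) / 2 * (-s * (n + 1 + u : ℂ) ^ (-s - 1))
      - (s - 1) * (1 - 2 * u) / 2 * (n + 1 + u : ℂ) ^ (-s) + (n + 1 + u : ℂ) ^ (1 - s)
  have hK : ∀ u ∈ Set.Icc (0 : ℝ) 1, HasDerivAt K
      ((s - 1) * (u * (1 - u)) / 2 * (s * (s + 1) * (n + 1 + u : ℂ) ^ (-s - 2))) u := by
    intro u hu
    have hslit : (n + 1 + u : ℂ) ∈ slitPlane := by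
      left
      have h1 := hu.1
      simp only [add_re, natCast_re, one_re, ofReal_re]
      positivity
    have hid : HasDerivAt (fun u : ℂ => (n + 1 + u : ℂ)) 1 (u : ℂ) :=
      (hasDerivAt_id _).const_add _
    have hp : ∀ a : ℂ, HasDerivAt (fun u : ℂ => (n + 1 + u : ℂ) ^ a)
        (a * (n + 1 + u : ℂ) ^ (a - 1) * 1) (u : ℂ) := fun a => hid.cpow_const hslit
    have hq : HasDerivAt (fun u : ℂ => (s - 1) * (u * (1 - u)) / 2)
        ((s - 1) * (1 - 2 * u) / 2) (u : ℂ) := by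
      have := (((hasDerivAt_id (u : ℂ)).mul ((hasDerivAt_id (u : ℂ)).const_sub 1)).const_mul
        (s - 1)).div_const 2
      refine this.congr_deriv ?_
      simp only [id]; ring
    have hl : HasDerivAt (fun u : ℂ => (s - 1) * (1 - 2 * u) / 2) (-(s - 1)) (u : ℂ) := by
      have := ((((hasDerivAt_id (u : ℂ)).const_mul 2).const_sub 1).const_mul (s - 1)).div_const 2
      refine this.congr_deriv ?_
      ring
    have := (((hq.mul ((hp (-s - 1)).const_mul (-s))).sub (hl.mul (hp (-s)))).add
      (hp (1 - s))).comp_ofReal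
    refine this.congr_deriv ?_
    rw [show -s - 1 - 1 = -s - 2 by ring, show 1 - s - 1 = -s by ring]
    ring
  have hbound : ∀ u ∈ Set.Ico (0 : ℝ) 1,
      ‖(s - 1) * (u * (1 - u)) / 2 * (s * (s + 1) * (n + 1 + u : ℂ) ^ (-s - 2))‖ ≤
        ‖s - 1‖ * ‖s‖ * ‖s + 1‖ / 8 * (1 / (n + 1 : ℝ) ^ (5 / 4 : ℝ)) := by
    intro u hu
    have hu0 := hu.1
    have hu1 := hu.2
    have hpos : 0 < (n + 1 + u : ℝ) := by positivity
    have hn1 : 1 ≤ (n + 1 + u : ℝ) := by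
      have : (0 : ℝ) ≤ n := Nat.cast_nonneg n
      linarith
    have e1 : ‖(n + 1 + u : ℂ) ^ (-s - 2)‖ = (n + 1 + u : ℝ) ^ (-s.re - 2) := by
      have : (n + 1 + u : ℂ) = ((n + 1 + u : ℝ) : ℂ) := by push_cast; ring
      rw [this, norm_cpow_eq_rpow_re_of_pos hpos]
      simp
    have e2 : (n + 1 + u : ℝ) ^ (-s.re - 2) ≤ 1 / (n + 1 : ℝ) ^ (5 / 4 : ℝ) := by
      calc (n + 1 + u : ℝ) ^ (-s.re - 2) ≤ (n + 1 + u : ℝ) ^ (-(5 / 4 : ℝ)) :=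
            Real.rpow_le_rpow_of_exponent_le hn1 (by linarith)
        _ = 1 / (n + 1 + u : ℝ) ^ (5 / 4 : ℝ) := by rw [Real.rpow_neg hpos.le, one_div]
        _ ≤ 1 / (n + 1 : ℝ) ^ (5 / 4 : ℝ) :=
            one_div_le_one_div_of_le (by positivity)
              (Real.rpow_le_rpow (by positivity) (by linarith) (by norm_num))
    have e3 : ‖(u * (1 - u) : ℂ)‖ ≤ 1 / 4 := by
      have : (u * (1 - u) : ℂ) = ((u * (1 - u) : ℝ) : ℂ) := by push_cast; ring
      rw [this, norm_real, Real.norm_of_nonneg (by nlinarith)]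
      nlinarith [sq_nonneg (u - 1 / 2)]
    have e4 : ‖(s - 1) * (u * (1 - u)) / 2 * (s * (s + 1) * (n + 1 + u : ℂ) ^ (-s - 2))‖ =
        ‖s - 1‖ * ‖s‖ * ‖s + 1‖ / 2 * (‖(u * (1 - u) : ℂ)‖ *
          ‖(n + 1 + u : ℂ) ^ (-s - 2)‖) := by
      simp only [norm_mul, norm_div, Complex.norm_ofNat]
      ring
    rw [e4, e1]
    calc _ ≤ ‖s - 1‖ * ‖s‖ * ‖s + 1‖ / 2 * (1 / 4 * (1 / (n + 1 : ℝ) ^ (5 / 4 : ℝ))) := by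
          gcongr
      _ = _ := by ring
  have h := norm_image_sub_le_of_norm_deriv_le_segment_01' (f := K)
    (fun u hu => (hK u hu).hasDerivWithinAt) hbound
  -- the quadratic weight vanishes at both ends, which leaves the trapezoidal sum
  have hT : K 1 - K 0 = trapezoidTerm n s := by
    simp only [K, trapezoidTerm]
    push_cast
    rw [show (n + 1 + 1 : ℂ) = n + 2 by ring, add_zero]
    ring
  rwa [hT] at h

theorem summable_one_div_rpow_five_quarters :
    Summable fun n : ℕ => 1 / (n + 1 : ℝ) ^ (5 / 4 : ℝ) := by
  have := (summable_nat_add_iff 1).mpr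
    (Real.summable_one_div_nat_rpow.mpr (by norm_num : (1 : ℝ) < 5 / 4))
  simpa using this

theorem tsum_one_div_rpow_five_quarters_le :
    ∑' n : ℕ, 1 / (n + 1 : ℝ) ^ (5 / 4 : ℝ) ≤ 5 := by
  have h := ZetaAsymptotics.zeta_limit_aux1 (s := 5 / 4) (by norm_num)
  have h2 : 0 ≤ ZetaAsymptotics.termTSum (5 / 4) :=
    tsum_nonneg fun n => ZetaAsymptotics.term_nonneg _ _
  norm_num at h ⊢
  linarith

theorem summable_trapezoidTerm {s : ℂ} (hs : -(3 / 4) ≤ s.re) :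
    Summable fun n => trapezoidTerm n s :=
  Summable.of_norm_bounded (summable_one_div_rpow_five_quarters.mul_left _)
    fun n => norm_trapezoidTerm_le n hs

/-- Summing the trapezoidal rule, in the region of absolute convergence. -/
theorem riemannZeta₁_eq_of_one_lt_re {s : ℂ} (hs : 1 < s.re) :
    riemannZeta₁ s = (s + 1) / 2 + ∑' n, trapezoidTerm n s := by
  have hs1 : s ≠ 1 := by rintro rfl; simp at hs
  have hsum1 : HasSum (fun n : ℕ => (n + 1 : ℂ) ^ (-s)) (riemannZeta s) := by
    have h1 : Summable fun n : ℕ => 1 / ((n + 1 : ℕ) : ℂ) ^ s :=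
      (summable_nat_add_iff 1).mpr (Complex.summable_one_div_nat_cpow.mpr hs)
    rw [zeta_eq_tsum_one_div_nat_add_one_cpow hs]
    convert! h1.hasSum using 2 <;> simp [cpow_neg]
  have hsum2 : HasSum (fun n : ℕ => (n + 2 : ℂ) ^ (-s)) (riemannZeta s - 1) := by
    have := (hasSum_nat_add_iff' 1).mpr hsum1
    simp only [Finset.range_one, Finset.sum_singleton, Nat.cast_zero, zero_add, one_cpow] at this
    refine this.congr_fun ?_
    intro n
    push_cast
    congr 1
    ring
  have hsum3 : HasSum (fun n : ℕ => (n + 2 : ℂ) ^ (1 - s) - (n + 1 : ℂ) ^ (1 - s)) (0 - 1) := by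
    have hsm : Summable fun n : ℕ => (n + 2 : ℂ) ^ (1 - s) - (n + 1 : ℂ) ^ (1 - s) := by
      refine ((summable_trapezoidTerm (by linarith : -(3 / 4) ≤ s.re)).sub
        ((hsum1.add hsum2).mul_left ((s - 1) / 2)).summable).congr fun n => ?_
      simp only [trapezoidTerm]; ring
    rw [hsm.hasSum_iff_tendsto_nat]
    have e : ∀ N : ℕ, ∑ n ∈ Finset.range N, ((n + 2 : ℂ) ^ (1 - s) - (n + 1 : ℂ) ^ (1 - s)) =
        (N + 1 : ℂ) ^ (1 - s) - 1 := by
      intro N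
      have := Finset.sum_range_sub (fun n : ℕ => (n + 1 : ℂ) ^ (1 - s)) N
      simp only [Nat.cast_zero, zero_add, one_cpow] at this
      rw [← this]
      refine Finset.sum_congr rfl fun n _ => ?_
      push_cast
      rw [show (n + 1 + 1 : ℂ) = n + 2 by ring]
    simp_rw [e]
    refine Filter.Tendsto.sub_const ?_ 1
    rw [tendsto_zero_iff_norm_tendsto_zero]
    have h2 : ∀ N : ℕ, ‖(N + 1 : ℂ) ^ (1 - s)‖ = ((N : ℝ) + 1) ^ (-(s.re - 1)) := by
      intro N
      have : (N + 1 : ℂ) = ((N + 1 : ℝ) : ℂ) := by push_cast; ring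
      rw [this, norm_cpow_eq_rpow_re_of_pos (by positivity)]
      simp
    simp_rw [h2]
    exact (tendsto_rpow_neg_atTop (by linarith : 0 < s.re - 1)).comp
      (Filter.tendsto_atTop_add_const_right _ 1 tendsto_natCast_atTop_atTop)
  have hT := ((hsum1.add hsum2).mul_left ((s - 1) / 2)).add hsum3
  have : ∑' n, trapezoidTerm n s = _ := hT.tsum_eq
  rw [this]
  have hz := riemannZeta_eq_inv_sub_mul hs1
  have : s - 1 ≠ 0 := sub_ne_zero.mpr hs1
  rw [hz]
  field_simp
  ring

/-- The trapezoidal expansion of `(s - 1) ζ(s)`, by analytic continuation from `re s > 1`. -/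
theorem riemannZeta₁_eq {s : ℂ} (hs : -(3 / 4) < s.re) :
    riemannZeta₁ s = (s + 1) / 2 + ∑' n, trapezoidTerm n s := by
  set B : ℝ := ‖s‖ + 3
  have hB : 3 ≤ B := by simp [B]
  let U : Set ℂ := {z : ℂ | -(3 / 4) < z.re} ∩ ball 0 B
  have hUo : IsOpen U := (isOpen_lt continuous_const continuous_re).inter isOpen_ball
  have hUc : Convex ℝ U := (convex_halfSpace_re_gt _).inter (convex_ball 0 B)
  have h2U : (2 : ℂ) ∈ U := ⟨by norm_num, by simp; linarith⟩
  have hsU : s ∈ U := ⟨hs, by simp [B]⟩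
  have hd : DifferentiableOn ℂ (fun z => ∑' n, trapezoidTerm n z) U := by
    refine differentiableOn_tsum_of_summable_norm
      (u := fun n => (B + 1) * B * (B + 1) / 8 * (1 / (n + 1 : ℝ) ^ (5 / 4 : ℝ)))
      (summable_one_div_rpow_five_quarters.mul_left _)
      (fun n => (differentiable_trapezoidTerm n).differentiableOn) hUo ?_
    intro n z hz
    have hzB : ‖z‖ ≤ B := by simpa using (mem_ball.mp hz.2).le
    refine (norm_trapezoidTerm_le n hz.1.le).trans ?_
    have h1 : ‖z - 1‖ ≤ B + 1 := (norm_sub_le _ _).trans (by simpa using hzB)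
    have h2 : ‖z + 1‖ ≤ B + 1 := (norm_add_le _ _).trans (by simpa using hzB)
    gcongr
  have han1 : AnalyticOnNhd ℂ riemannZeta₁ U := fun z _ => differentiable_riemannZeta₁.analyticAt z
  have han2 : AnalyticOnNhd ℂ (fun z => (z + 1) / 2 + ∑' n, trapezoidTerm n z) U :=
    DifferentiableOn.analyticOnNhd (DifferentiableOn.add (by fun_prop) hd) hUo
  refine han1.eqOn_of_preconnected_of_eventuallyEq han2 hUc.isPreconnected h2U ?_ hsU
  filter_upwards [(isOpen_lt continuous_const continuous_re).mem_nhds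
    (by norm_num : (1 : ℝ) < (2 : ℂ).re)] with z hz
  exact riemannZeta₁_eq_of_one_lt_re hz

/-- Polynomial growth of `(s - 1) ζ(s)`. -/
theorem norm_riemannZeta₁_le {s : ℂ} (hs : -(3 / 4) ≤ s.re) :
    ‖riemannZeta₁ s‖ ≤ 2 * (‖s‖ + 1) ^ 3 := by
  have key : ∀ z : ℂ, -(3 / 4) < z.re → ‖riemannZeta₁ z‖ ≤ 2 * (‖z‖ + 1) ^ 3 := by
    intro z hz
    rw [riemannZeta₁_eq hz]
    have h0 : 0 ≤ ‖z‖ := norm_nonneg z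
    have h1 : ‖z - 1‖ ≤ ‖z‖ + 1 := (norm_sub_le _ _).trans (by simp)
    have h2 : ‖z + 1‖ ≤ ‖z‖ + 1 := (norm_add_le _ _).trans (by simp)
    have h3 : ‖∑' n, trapezoidTerm n z‖ ≤ (‖z‖ + 1) * (‖z‖ + 1) * (‖z‖ + 1) / 8 * 5 := by
      have hb := fun n => norm_trapezoidTerm_le n hz.le
      refine (tsum_of_norm_bounded
        (summable_one_div_rpow_five_quarters.mul_left _).hasSum hb).trans ?_
      rw [tsum_mul_left]
      have := tsum_one_div_rpow_five_quarters_le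
      have h5 : 0 ≤ ∑' n : ℕ, 1 / (n + 1 : ℝ) ^ (5 / 4 : ℝ) := tsum_nonneg fun n => by positivity
      gcongr
      linarith
    have h4 : ‖(z + 1) / 2‖ ≤ (‖z‖ + 1) / 2 := by
      rw [norm_div]
      simpa using div_le_div_of_nonneg_right h2 (by norm_num : (0 : ℝ) ≤ 2)
    refine (norm_add_le _ _).trans ?_
    nlinarith [mul_nonneg h0 h0, mul_nonneg (mul_nonneg h0 h0) h0]
  -- the boundary line `re = -3/4` is reached by continuity
  have hlim : Filter.Tendsto (fun ε : ℝ => s + ε) (nhdsWithin 0 (Set.Ioi 0)) (nhds s) := by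
    have : Continuous fun ε : ℝ => s + ε := by fun_prop
    simpa using (this.tendsto 0).mono_left nhdsWithin_le_nhds
  have hc1 := (differentiable_riemannZeta₁.continuous.norm.tendsto s).comp hlim
  have hc2 : Filter.Tendsto (fun z : ℂ => 2 * (‖z‖ + 1) ^ 3) (nhds s)
      (nhds (2 * (‖s‖ + 1) ^ 3)) := Continuous.tendsto (by fun_prop) s
  refine le_of_tendsto_of_tendsto hc1 (hc2.comp hlim) ?_
  filter_upwards [self_mem_nhdsWithin] with ε hε
  have hε' : 0 < ε := hε
  exact key _ (by simp; linarith)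

/-! ### The zeros near a given height -/

theorem riemannZeta₁_eq_zero_iff {s : ℂ} : riemannZeta₁ s = 0 ↔ riemannZeta s = 0 := by
  rcases eq_or_ne s 1 with rfl | hs
  · simp [riemannZeta_one_ne_zero]
  · rw [riemannZeta_eq_inv_sub_mul hs]
    simp [sub_ne_zero.mpr hs]

/-- A lower bound at the centres of the discs, from `|ζ(2 + t i) - 1| ≤ π² / 6 - 1`. -/
theorem one_third_le_norm_riemannZeta₁ (t : ℝ) : 1 / 3 ≤ ‖riemannZeta₁ (2 + t * I)‖ := by
  set s : ℂ := 2 + t * I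
  have hre : s.re = 2 := by simp [s]
  have hs1 : s ≠ 1 := by intro h; rw [h] at hre; norm_num at hre
  have hF : riemannZeta₁ s = (s - 1) * riemannZeta s := by
    rw [riemannZeta_eq_inv_sub_mul hs1, mul_inv_cancel_left₀ (sub_ne_zero.mpr hs1)]
  have hs1' : 1 ≤ ‖s - 1‖ := by
    have := abs_re_le_norm (s - 1)
    rw [sub_re, hre] at this
    norm_num at this
    exact this
  have hz : ‖riemannZeta s - 1‖ ≤ Real.pi ^ 2 / 6 - 1 := by
    have hs : 1 < s.re := by rw [hre]; norm_num
    have h1 : HasSum (fun n : ℕ => 1 / ((n + 1 : ℕ) : ℂ) ^ s) (riemannZeta s) := by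
      have h1 : Summable fun n : ℕ => 1 / ((n + 1 : ℕ) : ℂ) ^ s :=
        (summable_nat_add_iff 1).mpr (Complex.summable_one_div_nat_cpow.mpr hs)
      rw [zeta_eq_tsum_one_div_nat_add_one_cpow hs]
      convert! h1.hasSum using 2
      push_cast; rfl
    have h2 := (hasSum_nat_add_iff' 1).mpr h1
    have h3 : HasSum (fun n : ℕ => 1 / ((n + 1 : ℕ) : ℝ) ^ 2) (Real.pi ^ 2 / 6) := by
      simpa using (hasSum_nat_add_iff' 1).mpr hasSum_zeta_two
    have h4 := (hasSum_nat_add_iff' 1).mpr h3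
    simp only [Finset.range_one, Finset.sum_singleton, zero_add, Nat.cast_one, one_cpow, div_one,
      one_pow] at h2 h4
    refine h2.norm_le_of_bounded h4 fun n => le_of_eq ?_
    rw [norm_div, norm_one, norm_natCast_cpow_of_pos (by omega), hre]
    norm_num
  have hz' : 1 / 3 ≤ ‖riemannZeta s‖ := by
    have h1 := norm_sub_norm_le (1 : ℂ) (1 - riemannZeta s)
    rw [norm_one, sub_sub_cancel, norm_sub_rev] at h1
    have h2 : Real.pi ^ 2 ≤ 10 := by nlinarith [Real.pi_lt_d2, Real.pi_pos]
    linarith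
  rw [hF, norm_mul]
  nlinarith [norm_nonneg (riemannZeta s)]

/-- Apart from the trivial zeros, which are real and at most `-2`, all zeros of the zeta function
lie in the open critical strip. -/
theorem re_mem_Ioo_of_riemannZeta_eq_zero {s : ℂ} (h0 : riemannZeta s = 0)
    (hs : s.im ≠ 0 ∨ -2 < s.re) : s.re ∈ Set.Ioo (0 : ℝ) 1 := by
  have h1 : s.re < 1 := by
    by_contra! h
    exact riemannZeta_ne_zero_of_one_le_re h h0
  refine ⟨?_, h1⟩
  by_contra! h
  set w : ℂ := 1 - s
  have hw : s = 1 - w := by simp [w]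
  have hwre : 1 ≤ w.re := by simp [w]; linarith
  have hs0 : s ≠ 0 := by
    rintro rfl
    rw [riemannZeta_zero] at h0
    norm_num at h0
  have hw1 : w ≠ 1 := by
    intro h; apply hs0; rw [hw, h, sub_self]
  have hwn : ∀ n : ℕ, w ≠ -n := by
    intro n hn
    rw [hn] at hwre
    simp at hwre
    linarith [(Nat.cast_nonneg n : (0 : ℝ) ≤ n)]
  rw [hw, riemannZeta_one_sub hwn hw1] at h0
  have hζ := riemannZeta_ne_zero_of_one_le_re hwre
  have hΓ : Gamma w ≠ 0 := Gamma_ne_zero hwn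
  have hpi : (2 * Real.pi : ℂ) ^ (-w) ≠ 0 := by
    rw [cpow_ne_zero_iff]
    left
    exact_mod_cast Real.two_pi_pos.ne'
  have hcos : cos (Real.pi * w / 2) = 0 := by simpa [hζ, hΓ, hpi] using h0
  obtain ⟨k, hk⟩ := cos_eq_zero_iff.mp hcos
  have hwk : w = 2 * k + 1 := by
    have : (Real.pi : ℂ) ≠ 0 := by exact_mod_cast Real.pi_ne_zero
    field_simp at hk
    exact hk
  rcases hs with hs | hs
  · apply hs
    have := congrArg im hwk
    simpa [w] using this
  · have hre : w.re = 2 * k + 1 := by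
      have := congrArg re hwk
      simpa using this
    have h3 : w.re < 3 := by simp [w]; linarith
    have hk0 : k = 0 := by
      have a1 : -1 < k := by
        have : (-1 : ℝ) < k := by linarith
        exact_mod_cast this
      have a2 : k < 1 := by
        have : (k : ℝ) < 1 := by linarith
        exact_mod_cast this
      omega
    apply hw1
    rw [hwk, hk0]; simp

theorem finite_zeros_closedBall (t : ℝ) :
    (closedBall (2 + t * I : ℂ) (5 / 2) ∩ riemannZetaZeros).Finite :=
  (isCompact_closedBall _ _).inter_riemannZetaZeros_finite

/-- The zeros of the zeta function within distance `5 / 2` of `2 + t i`, without multiplicities. The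
disc reaches to the left of the critical strip by `1 / 2`, and it avoids the trivial zeros. -/
noncomputable def nearbyZeros (t : ℝ) : Finset ℂ := (finite_zeros_closedBall t).toFinset

theorem mem_nearbyZeros {t : ℝ} {ρ : ℂ} :
    ρ ∈ nearbyZeros t ↔ ρ ∈ closedBall (2 + t * I : ℂ) (5 / 2) ∧ riemannZeta ρ = 0 := by
  simp [nearbyZeros, mem_riemannZetaZeros]

/-- There are `O(log t)` zeros near height `t`, and `ζ'/ζ` differs by `O(log t)` from the sum of
its principal parts at these zeros. Three concentric circles around `2 + t i` are used: the outer
one, of radius `11 / 4`, still lies in the half-plane where `norm_riemannZeta₁_le` holds, and the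
inner one, of radius `9 / 4`, reaches to the line `re s = -1 / 4`. -/
theorem nearbyZeros_bounds (t : ℝ) :
    (∑ ρ ∈ nearbyZeros t, analyticOrderNatAt riemannZeta₁ ρ : ℕ) ≤ 55 * Real.log (|t| + 6) ∧
      ∀ s ∈ closedBall (2 + t * I : ℂ) (9 / 4), riemannZeta₁ s ≠ 0 →
        ‖logDeriv riemannZeta₁ s -
          ∑ ρ ∈ nearbyZeros t, (analyticOrderNatAt riemannZeta₁ ρ : ℂ) / (s - ρ)‖ ≤
            1800 * Real.log (|t| + 6) := by
  set c : ℂ := 2 + t * I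
  set ℓ : ℝ := Real.log (|t| + 6)
  have ht := abs_nonneg t
  have h13 := one_third_le_norm_riemannZeta₁ t
  have hM : (1 : ℝ) < 6 * (|t| + 6) ^ 3 := by
    nlinarith [pow_le_pow_left₀ (by norm_num) (by linarith : (6 : ℝ) ≤ |t| + 6) 3]
  have hlogM : Real.log (6 * (|t| + 6) ^ 3) ≤ 4 * ℓ := by
    rw [show 4 * ℓ = Real.log ((|t| + 6) ^ 4) by rw [Real.log_pow]; norm_num; rfl]
    apply Real.log_le_log (by linarith)
    nlinarith [pow_pos (by linarith : (0 : ℝ) < |t| + 6) 3]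
  have hb : ∀ z ∈ sphere c (11 / 4), ‖riemannZeta₁ z‖ ≤ 6 * (|t| + 6) ^ 3 * ‖riemannZeta₁ c‖ := by
    intro z hz
    have hz' : ‖z - c‖ = 11 / 4 := by simpa [dist_eq] using hz
    have hre : -(3 / 4) ≤ z.re := by
      have h1 := (abs_le.mp ((abs_re_le_norm (z - c)).trans hz'.le)).1
      simp [c] at h1
      linarith
    have hn : ‖z‖ + 1 ≤ |t| + 6 := by
      have h1 : ‖z‖ ≤ ‖z - c‖ + ‖c‖ := by simpa using norm_add_le (z - c) c
      have h2 : ‖c‖ ≤ 2 + |t| := (norm_add_le _ _).trans (by simp)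
      linarith
    calc ‖riemannZeta₁ z‖ ≤ 2 * (‖z‖ + 1) ^ 3 := norm_riemannZeta₁_le hre
      _ ≤ 2 * (|t| + 6) ^ 3 := by gcongr
      _ = 6 * (|t| + 6) ^ 3 * (1 / 3) := by ring
      _ ≤ _ := by gcongr
  obtain ⟨h1, h2⟩ := zero_count_and_logDeriv_bound differentiable_riemannZeta₁
    (r₀ := 9 / 4) (r := 5 / 2) (R := 11 / 4) (by norm_num) (by norm_num) (by norm_num) hM
    (norm_pos_iff.mp (by linarith)) hb (nearbyZeros t)
    (fun ρ hρ => (mem_nearbyZeros.mp hρ).1)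
    (fun ρ hρ => riemannZeta₁_eq_zero_iff.mpr (mem_nearbyZeros.mp hρ).2)
    (fun z hz h0 => mem_nearbyZeros.mpr ⟨hz, riemannZeta₁_eq_zero_iff.mp h0⟩)
  set N : ℕ := ∑ ρ ∈ nearbyZeros t, analyticOrderNatAt riemannZeta₁ ρ
  have hN : (N : ℝ) ≤ 55 * ℓ := by
    have h3 := Real.log_le_log (by positivity) h1
    rw [Real.log_pow] at h3
    have h4 : 1 / 11 ≤ Real.log (11 / 4 / (5 / 2)) := by
      have := Real.one_sub_inv_le_log_of_pos (x := 11 / 4 / (5 / 2)) (by norm_num)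
      norm_num at this ⊢
      linarith
    have h5 : (N : ℝ) * (1 / 11) ≤ N * Real.log (11 / 4 / (5 / 2)) := by gcongr
    linarith
  refine ⟨hN, fun s hs hs0 => (h2 s hs hs0).trans ?_⟩
  norm_num
  linarith

/-- The logarithmic derivative of `(s - 1) ζ(s)`, in terms of the distance to the zeros. -/
theorem norm_logDeriv_riemannZeta₁_le {σ t δ : ℝ} (hσ : -(1 / 4) ≤ σ) (hσ2 : σ ≤ 2)
    (hδ : 0 < δ) (hz : ∀ ρ : ℂ, riemannZeta ρ = 0 → ρ.re ∈ Set.Ioo (0 : ℝ) 1 →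
      δ ≤ ‖(σ + t * I : ℂ) - ρ‖) :
    ‖logDeriv riemannZeta₁ (σ + t * I)‖ ≤ (55 / δ + 1800) * Real.log (|t| + 6) := by
  set s : ℂ := σ + t * I
  have hre : s.re = σ := by simp [s]
  obtain ⟨h1, h2⟩ := nearbyZeros_bounds t
  have hs : s ∈ closedBall (2 + t * I : ℂ) (9 / 4) := by
    rw [mem_closedBall, dist_eq, show s - (2 + t * I) = ((σ - 2 : ℝ) : ℂ) by simp [s],
      norm_real, Real.norm_eq_abs, abs_le]
    constructor <;> linarith
  have hs0 : riemannZeta₁ s ≠ 0 := by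
    intro h0
    have h0' := riemannZeta₁_eq_zero_iff.mp h0
    have := hz s h0' (re_mem_Ioo_of_riemannZeta_eq_zero h0' (Or.inr (by rw [hre]; linarith)))
    simp at this
    linarith
  have h3 := h2 s hs hs0
  have h4 : ‖∑ ρ ∈ nearbyZeros t, (analyticOrderNatAt riemannZeta₁ ρ : ℂ) / (s - ρ)‖ ≤
      55 / δ * Real.log (|t| + 6) := by
    refine (norm_sum_le _ _).trans ?_
    calc _ ≤ ∑ ρ ∈ nearbyZeros t, (analyticOrderNatAt riemannZeta₁ ρ : ℝ) / δ := by
          refine Finset.sum_le_sum fun ρ hρ => ?_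
          rw [norm_div, Complex.norm_natCast]
          obtain ⟨hb, h0⟩ := mem_nearbyZeros.mp hρ
          have hre : -2 < ρ.re := by
            rw [mem_closedBall, dist_eq] at hb
            have h1 := (abs_le.mp ((abs_re_le_norm _).trans hb)).1
            simp at h1
            linarith
          gcongr
          exact hz ρ h0 (re_mem_Ioo_of_riemannZeta_eq_zero h0 (Or.inr hre))
      _ = (∑ ρ ∈ nearbyZeros t, analyticOrderNatAt riemannZeta₁ ρ : ℕ) / δ := by
          rw [← Finset.sum_div]; push_cast; rfl
      _ ≤ 55 * Real.log (|t| + 6) / δ := by gcongr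
      _ = _ := by ring
  calc ‖logDeriv riemannZeta₁ s‖ ≤ ‖logDeriv riemannZeta₁ s -
        ∑ ρ ∈ nearbyZeros t, (analyticOrderNatAt riemannZeta₁ ρ : ℂ) / (s - ρ)‖ +
        ‖∑ ρ ∈ nearbyZeros t, (analyticOrderNatAt riemannZeta₁ ρ : ℂ) / (s - ρ)‖ := by
          simpa using norm_add_le (logDeriv riemannZeta₁ s -
            ∑ ρ ∈ nearbyZeros t, (analyticOrderNatAt riemannZeta₁ ρ : ℂ) / (s - ρ))
            (∑ ρ ∈ nearbyZeros t, (analyticOrderNatAt riemannZeta₁ ρ : ℂ) / (s - ρ))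
    _ ≤ _ := by linarith

/-! ### Gaps between ordinates, and symmetry of the zeros -/

theorem analyticOrderNatAt_riemannZeta₁ {ρ : ℂ} (hρ : ρ ≠ 1) :
    analyticOrderNatAt riemannZeta₁ ρ = analyticOrderNatAt riemannZeta ρ := by
  have h1 : riemannZeta =ᶠ[nhds ρ] (fun s => (s - 1)⁻¹) * riemannZeta₁ := by
    filter_upwards [isOpen_ne.mem_nhds hρ] with s hs using riemannZeta_eq_inv_sub_mul hs
  have han : AnalyticAt ℂ (fun s : ℂ => (s - 1)⁻¹) ρ :=
    (analyticAt_id.sub analyticAt_const).inv (sub_ne_zero.mpr hρ)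
  have h0 : analyticOrderAt (fun s : ℂ => (s - 1)⁻¹) ρ = 0 :=
    han.analyticOrderAt_eq_zero.mpr (inv_ne_zero (sub_ne_zero.mpr hρ))
  unfold analyticOrderNatAt
  rw [analyticOrderAt_congr h1, analyticOrderAt_mul han (differentiable_riemannZeta₁.analyticAt ρ),
    h0, zero_add]

theorem exists_riemannZeta₁_ne_zero : ∃ z, riemannZeta₁ z ≠ 0 := ⟨1, by simp⟩

theorem one_le_analyticOrderNatAt_riemannZeta₁ {ρ : ℂ} (h : riemannZeta ρ = 0) :
    1 ≤ analyticOrderNatAt riemannZeta₁ ρ := by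
  rw [Nat.one_le_iff_ne_zero]
  intro h0
  have h1 := Nat.cast_analyticOrderNatAt
    (analyticOrderAt_ne_top_of_entire differentiable_riemannZeta₁ exists_riemannZeta₁_ne_zero ρ)
  rw [h0, Nat.cast_zero] at h1
  exact (differentiable_riemannZeta₁.analyticAt ρ).analyticOrderAt_eq_zero.mp h1.symm
    (riemannZeta₁_eq_zero_iff.mpr h)

theorem card_nearbyZeros_le (t : ℝ) : ((nearbyZeros t).card : ℝ) ≤ 55 * Real.log (|t| + 6) := by
  refine le_trans ?_ (nearbyZeros_bounds t).1
  rw [Finset.card_eq_sum_ones]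
  exact_mod_cast Finset.sum_le_sum fun ρ hρ =>
    one_le_analyticOrderNatAt_riemannZeta₁ (mem_nearbyZeros.mp hρ).2

/-- An associate of `T` is close to `T`, and by the pigeonhole principle it keeps a distance of
order `1 / log T` from all ordinates of zeros. -/
theorem IsAssociate.gap {T Tu : ℝ} (hT : 2 ≤ T) (h : IsAssociate T 1.155 Tu) :
    |Tu - T| ≤ 1.155 ∧ ∀ ρ : ℂ, riemannZeta ρ = 0 →
      1.155 / (55 * Real.log (T + 6) + 1) ≤ |Tu - ρ.im| := by
  obtain ⟨n, z, hz0, hzn, hmono, himg, j, hj, hmax, hTu⟩ := h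
  have hmem : ∀ k ∈ Set.Icc 1 n, T - 1.155 ≤ z k ∧ z k ≤ T + 1.155 ∧
      ∃ s : ℂ, riemannZeta s = 0 ∧ s.im = z k := by
    intro k hk
    have : z k ∈ z '' Set.Icc 1 n := ⟨k, hk, rfl⟩
    rwa [himg] at this
  have hstep : ∀ i ≤ n, z i ≤ z (i + 1) := by
    intro i hi
    rcases Nat.eq_zero_or_pos i with rfl | hi0
    · rcases Nat.eq_zero_or_pos n with rfl | hn
      · rw [hz0, hzn]; linarith
      · rw [hz0]
        exact (hmem 1 ⟨le_rfl, hn⟩).1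
    · rcases hi.eq_or_lt with rfl | hlt
      · rw [hzn]
        exact (hmem i ⟨hi0, le_rfl⟩).2.1
      · exact (hmono ⟨hi0, hi⟩ ⟨by omega, hlt⟩ (Nat.lt_succ_self i)).le
  have hle : ∀ i k, i ≤ k → k ≤ n + 1 → z i ≤ z k := by
    intro i k hik
    induction k, hik using Nat.le_induction with
    | base => intro _; exact le_rfl
    | succ k _ ih => intro hk; exact (ih (by omega)).trans (hstep k (by omega))
  set g := z (j + 1) - z j with hg
  -- pigeonhole: `2.31` is the length of the window, divided into `n + 1` intervals
  have hsum : 2.31 ≤ (n + 1 : ℝ) * g := by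
    have h1 : ∑ i ∈ Finset.range (n + 1), (z (i + 1) - z i) = 2.31 := by
      rw [Finset.sum_range_sub, hz0, hzn]; norm_num
    rw [← h1]
    refine (Finset.sum_le_card_nsmul _ _ g fun i hi => hmax i ?_).trans (le_of_eq ?_)
    · have := Finset.mem_range.mp hi; omega
    · simp
  have hcard : n ≤ (nearbyZeros T).card := by
    have hsub : (Finset.Icc 1 n).image z ⊆ (nearbyZeros T).image im := by
      intro y hy
      obtain ⟨k, hk, rfl⟩ := Finset.mem_image.mp hy
      obtain ⟨ha, hb, s, hs0, hs⟩ := hmem k (by simpa using hk)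
      refine Finset.mem_image.mpr ⟨s, mem_nearbyZeros.mpr ⟨?_, hs0⟩, hs⟩
      have him : s.im ≠ 0 := by rw [hs]; linarith
      obtain ⟨hr0, hr1⟩ := re_mem_Ioo_of_riemannZeta_eq_zero hs0 (Or.inl him)
      rw [mem_closedBall, dist_eq, Complex.norm_def]
      refine Real.sqrt_le_iff.mpr ⟨by norm_num, ?_⟩
      simp only [normSq_apply, sub_re, sub_im, add_re, add_im, mul_re, mul_im, ofReal_re,
        ofReal_im, I_re, I_im, re_ofNat, im_ofNat, hs]
      nlinarith
    have hinj : Set.InjOn z (Finset.Icc 1 n : Finset ℕ) := by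
      rw [Finset.coe_Icc]; exact hmono.injOn
    calc n = ((Finset.Icc 1 n).image z).card := by rw [Finset.card_image_of_injOn hinj]; simp
      _ ≤ ((nearbyZeros T).image im).card := Finset.card_le_card hsub
      _ ≤ _ := Finset.card_image_le
  have hn : (n : ℝ) ≤ 55 * Real.log (T + 6) := by
    have h1 := card_nearbyZeros_le T
    rw [abs_of_pos (by linarith : 0 < T)] at h1
    exact le_trans (by exact_mod_cast hcard) h1
  have hg0 : 0 < g := by
    by_contra! h
    nlinarith [(Nat.cast_nonneg n : (0 : ℝ) ≤ n)]
  have hg2 : 1.155 / (55 * Real.log (T + 6) + 1) ≤ g / 2 := by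
    have h0 : (0 : ℝ) ≤ n := Nat.cast_nonneg n
    rw [div_le_iff₀ (by linarith)]
    nlinarith
  have hj0 := hle 0 j (by omega) (by omega)
  have hj1 := hle (j + 1) (n + 1) (by omega) le_rfl
  rw [hz0] at hj0
  rw [hzn] at hj1
  refine ⟨abs_le.mpr ⟨by linarith, by linarith⟩, fun ρ hρ => hg2.trans ?_⟩
  have hcases : ρ.im ≤ z j ∨ z (j + 1) ≤ ρ.im := by
    by_cases h1 : ρ.im < T - 1.155
    · left; linarith
    by_cases h2 : T + 1.155 < ρ.im
    · right; linarith
    have h3 : ρ.im ∈ z '' Set.Icc 1 n := by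
      rw [himg]
      exact ⟨not_lt.mp h1, not_lt.mp h2, ρ, hρ, rfl⟩
    obtain ⟨k, hk, hzk⟩ := h3
    have hk1 := hk.1
    have hk2 := hk.2
    rw [← hzk]
    rcases Nat.lt_or_ge j k with hjk | hjk
    · right; exact hle _ _ hjk (by omega)
    · left; exact hle _ _ hjk (by omega)
  rcases hcases with h1 | h1
  · rw [le_abs]; left; linarith
  · rw [le_abs]; right; linarith

/-- Conjugate zeros have the same multiplicity. -/
theorem analyticOrderNatAt_riemannZeta₁_conj (ρ : ℂ) :
    analyticOrderNatAt riemannZeta₁ (conj ρ) = analyticOrderNatAt riemannZeta₁ ρ := by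
  have hF : ∀ s, riemannZeta₁ (conj s) = conj (riemannZeta₁ s) := by
    intro s
    rcases eq_or_ne s 1 with rfl | hs
    · simp
    · have hs' : conj s ≠ 1 := fun h => hs (by simpa using congrArg conj h)
      have h1 := riemannZeta_conj s
      rw [riemannZeta_eq_inv_sub_mul hs, riemannZeta_eq_inv_sub_mul hs'] at h1
      simp only [map_mul, map_inv₀, map_sub, map_one] at h1
      exact mul_left_cancel₀ (inv_ne_zero (sub_ne_zero.mpr hs')) h1
  obtain ⟨g, hg, hgρ, hgF⟩ := exists_entire_eq_pow_mul differentiable_riemannZeta₁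
    exists_riemannZeta₁_ne_zero ρ
  set n := analyticOrderNatAt riemannZeta₁ ρ
  have hg' : Differentiable ℂ fun z => conj (g (conj z)) := fun z =>
    differentiableAt_conj_conj_iff.mpr (hg _)
  have : analyticOrderAt riemannZeta₁ (conj ρ) = n := by
    rw [(differentiable_riemannZeta₁.analyticAt _).analyticOrderAt_eq_natCast]
    refine ⟨_, hg'.analyticAt _, by simpa using hgρ, Filter.Eventually.of_forall fun z => ?_⟩
    have h1 := congrArg conj (hgF (conj z))
    rw [← hF, conj_conj] at h1
    rw [h1]
    simp
  unfold analyticOrderNatAt at this ⊢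
  rw [this]
  rfl

/-- The zeros are symmetric about the real axis, so the sum over them is real. -/
theorem conj_zeroSum {x : ℝ} (hx : 0 < x) (H : ℝ) : conj (zeroSum x H) = zeroSum x H := by
  unfold zeroSum
  rw [map_sum]
  refine Finset.sum_bij' (fun ρ _ => conj ρ) (fun ρ _ => conj ρ) ?_ ?_ (by simp) (by simp) ?_
  · intro ρ hρ
    simpa [nontrivialZerosUpTo] using hρ
  · intro ρ hρ
    simpa [nontrivialZerosUpTo] using hρ
  · intro ρ hρ
    have h : 0 < ρ.re ∧ ρ.re < 1 := by
      simp only [nontrivialZerosUpTo, Set.Finite.mem_toFinset, Set.mem_ofPred_eq] at hρ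
      exact ⟨hρ.2.1, hρ.2.2.1⟩
    have h1 : ρ ≠ 1 := by rintro rfl; simp at h
    have h2 : conj ρ ≠ 1 := fun h => h1 (by simpa using congrArg conj h)
    rw [← analyticOrderNatAt_riemannZeta₁ h1, ← analyticOrderNatAt_riemannZeta₁ h2,
      analyticOrderNatAt_riemannZeta₁_conj]
    simp only [map_mul, map_div₀, map_natCast]
    rw [cpow_conj _ ρ (by rw [arg_ofReal_of_nonneg hx.le]; exact Real.pi_pos.ne), conj_ofReal]

/-! ### Integrals along the boundary of a rectangle -/

/-- The integral of `f` counterclockwise along the boundary of the rectangle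
`[a, b] × [c, d]`. -/
noncomputable def rectIntegral (f : ℂ → ℂ) (a b c d : ℝ) : ℂ :=
  (∫ x : ℝ in a..b, f (x + c * I)) - (∫ x : ℝ in a..b, f (x + d * I)) +
    I * (∫ y : ℝ in c..d, f (b + y * I)) - I * ∫ y : ℝ in c..d, f (a + y * I)

/-- The boundary of the rectangle `[a, b] × [c, d]`. -/
def rectBoundary (a b c d : ℝ) : Set ℂ :=
  {s | s.re ∈ Set.Icc a b ∧ s.im ∈ Set.Icc c d ∧ (s.re = a ∨ s.re = b ∨ s.im = c ∨ s.im = d)}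

section Rectangle

variable {a b c d : ℝ} {f g : ℂ → ℂ}

theorem horizontal_mem_rectBoundary (hcd : c ≤ d) {x y : ℝ} (hx : x ∈ Set.Icc a b)
    (hy : y = c ∨ y = d) : (x + y * I : ℂ) ∈ rectBoundary a b c d := by
  refine ⟨by simpa using hx, ?_, ?_⟩
  · rcases hy with rfl | rfl <;> simp [hcd]
  · rcases hy with rfl | rfl <;> simp

theorem vertical_mem_rectBoundary (hab : a ≤ b) {x y : ℝ} (hy : y ∈ Set.Icc c d)
    (hx : x = a ∨ x = b) : (x + y * I : ℂ) ∈ rectBoundary a b c d := by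
  refine ⟨?_, by simpa using hy, ?_⟩
  · rcases hx with rfl | rfl <;> simp [hab]
  · rcases hx with rfl | rfl <;> simp

theorem ContinuousOn.intervalIntegrable_horizontal (hab : a ≤ b) (hcd : c ≤ d)
    (hf : ContinuousOn f (rectBoundary a b c d)) {y : ℝ} (hy : y = c ∨ y = d) :
    IntervalIntegrable (fun x : ℝ => f (x + y * I)) MeasureTheory.volume a b := by
  apply ContinuousOn.intervalIntegrable
  rw [Set.uIcc_of_le hab]
  exact hf.comp (by fun_prop) fun x hx => horizontal_mem_rectBoundary hcd hx hy

theorem ContinuousOn.intervalIntegrable_vertical (hab : a ≤ b) (hcd : c ≤ d)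
    (hf : ContinuousOn f (rectBoundary a b c d)) {x : ℝ} (hx : x = a ∨ x = b) :
    IntervalIntegrable (fun y : ℝ => f (x + y * I)) MeasureTheory.volume c d := by
  apply ContinuousOn.intervalIntegrable
  rw [Set.uIcc_of_le hcd]
  exact hf.comp (by fun_prop) fun y hy => vertical_mem_rectBoundary hab hy hx

theorem rectIntegral_congr (hab : a ≤ b) (hcd : c ≤ d)
    (h : Set.EqOn f g (rectBoundary a b c d)) :
    rectIntegral f a b c d = rectIntegral g a b c d := by
  have h1 : ∀ y, y = c ∨ y = d →
      ∫ x : ℝ in a..b, f (x + y * I) = ∫ x : ℝ in a..b, g (x + y * I) := fun y hy =>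
    intervalIntegral.integral_congr fun x hx =>
      h (horizontal_mem_rectBoundary hcd (by rwa [Set.uIcc_of_le hab] at hx) hy)
  have h2 : ∀ x, x = a ∨ x = b →
      ∫ y : ℝ in c..d, f (x + y * I) = ∫ y : ℝ in c..d, g (x + y * I) := fun x hx =>
    intervalIntegral.integral_congr fun y hy =>
      h (vertical_mem_rectBoundary hab (by rwa [Set.uIcc_of_le hcd] at hy) hx)
  unfold rectIntegral
  rw [h1 c (Or.inl rfl), h1 d (Or.inr rfl), h2 a (Or.inl rfl), h2 b (Or.inr rfl)]

theorem rectIntegral_add (hab : a ≤ b) (hcd : c ≤ d)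
    (hf : ContinuousOn f (rectBoundary a b c d)) (hg : ContinuousOn g (rectBoundary a b c d)) :
    rectIntegral (fun s => f s + g s) a b c d =
      rectIntegral f a b c d + rectIntegral g a b c d := by
  unfold rectIntegral
  rw [intervalIntegral.integral_add (hf.intervalIntegrable_horizontal hab hcd (Or.inl rfl))
      (hg.intervalIntegrable_horizontal hab hcd (Or.inl rfl)),
    intervalIntegral.integral_add (hf.intervalIntegrable_horizontal hab hcd (Or.inr rfl))
      (hg.intervalIntegrable_horizontal hab hcd (Or.inr rfl)),
    intervalIntegral.integral_add (hf.intervalIntegrable_vertical hab hcd (Or.inl rfl))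
      (hg.intervalIntegrable_vertical hab hcd (Or.inl rfl)),
    intervalIntegral.integral_add (hf.intervalIntegrable_vertical hab hcd (Or.inr rfl))
      (hg.intervalIntegrable_vertical hab hcd (Or.inr rfl))]
  ring

theorem rectIntegral_const_mul (k : ℂ) :
    rectIntegral (fun s => k * f s) a b c d = k * rectIntegral f a b c d := by
  unfold rectIntegral
  simp only [intervalIntegral.integral_const_mul]
  ring

theorem rectIntegral_sum (hab : a ≤ b) (hcd : c ≤ d) {ι : Type*} (S : Finset ι)
    {F : ι → ℂ → ℂ} (hF : ∀ i ∈ S, ContinuousOn (F i) (rectBoundary a b c d)) :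
    rectIntegral (fun s => ∑ i ∈ S, F i s) a b c d = ∑ i ∈ S, rectIntegral (F i) a b c d := by
  classical
  induction S using Finset.induction_on with
  | empty => simp [rectIntegral]
  | insert i S hi ih =>
    simp only [Finset.sum_insert hi]
    rw [rectIntegral_add hab hcd (hF i (Finset.mem_insert_self i S))
      (continuousOn_finsetSum S fun j hj => hF j (Finset.mem_insert_of_mem hj)),
      ih fun j hj => hF j (Finset.mem_insert_of_mem hj)]

theorem rectIntegral_eq_zero (hab : a ≤ b) (hcd : c ≤ d)
    (hf : DifferentiableOn ℂ f (Set.Icc a b ×ℂ Set.Icc c d)) : rectIntegral f a b c d = 0 := by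
  have := integral_boundary_rect_eq_zero_of_differentiableOn f (⟨a, c⟩ : ℂ) (⟨b, d⟩ : ℂ)
    (by simpa [Set.uIcc_of_le hab, Set.uIcc_of_le hcd] using hf)
  simpa [rectIntegral] using this

theorem log_neg_eq_of_im_pos {z : ℂ} (hz : 0 < z.im) : log (-z) = log z - Real.pi * I := by
  rw [log, log, norm_neg, arg_neg_eq_arg_sub_pi_of_im_pos hz]
  push_cast; ring

theorem log_neg_eq_of_im_neg {z : ℂ} (hz : z.im < 0) : log (-z) = log z + Real.pi * I := by
  rw [log, log, norm_neg, arg_neg_eq_arg_add_pi_of_im_neg hz]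
  push_cast; ring

/-- The winding number of the boundary of a rectangle. On the top, bottom and right sides the
principal branch `log (s - w)` is a primitive, on the left side `log (-(s - w))` is; the two
branches differ by `π i` at the upper and by `-π i` at the lower left corner. -/
theorem rectIntegral_inv_sub {w : ℂ} (ha : a < w.re) (hb : w.re < b) (hc : c < w.im)
    (hd : w.im < d) : rectIntegral (fun s => (s - w)⁻¹) a b c d = 2 * Real.pi * I := by
  have hslit : ∀ z : ℂ, z.im ≠ 0 ∨ 0 < z.re → z ∈ slitPlane := fun z hz => hz.symm
  have hz0 : ∀ z : ℂ, z.im ≠ 0 ∨ z.re ≠ 0 → z ≠ 0 := by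
    rintro z hz rfl; simp at hz
  have hor : ∀ y : ℝ, y ≠ w.im → ∫ x : ℝ in a..b, (x + y * I - w)⁻¹ =
      log (b + y * I - w) - log (a + y * I - w) := by
    intro y hy
    have him : ∀ x : ℝ, (x + y * I - w : ℂ).im ≠ 0 := by
      intro x; simpa [sub_eq_zero] using hy
    refine intervalIntegral.integral_eq_sub_of_hasDerivAt
      (f := fun x : ℝ => log (x + y * I - w)) (fun x _ => ?_) ?_
    · have h1 : HasDerivAt (fun z : ℂ => z + y * I - w) 1 (x : ℂ) :=
        ((hasDerivAt_id (x : ℂ)).add_const _).sub_const w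
      have := (h1.clog (hslit _ (Or.inl (him x)))).comp_ofReal
      simpa using this
    · apply Continuous.intervalIntegrable
      exact Continuous.inv₀ (by fun_prop) fun x => hz0 _ (Or.inl (him x))
  have hright : I * ∫ y : ℝ in c..d, (b + y * I - w)⁻¹ =
      log (b + d * I - w) - log (b + c * I - w) := by
    have hre : ∀ y : ℝ, 0 < (b + y * I - w : ℂ).re := by intro y; simpa using hb
    rw [← intervalIntegral.integral_const_mul]
    refine intervalIntegral.integral_eq_sub_of_hasDerivAt
      (f := fun y : ℝ => log (b + y * I - w)) (fun y _ => ?_) ?_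
    · have h1 : HasDerivAt (fun z : ℂ => b + z * I - w) I (y : ℂ) := by
        simpa using (((hasDerivAt_id (y : ℂ)).mul_const I).const_add (b : ℂ)).sub_const w
      have := (h1.clog (hslit _ (Or.inr (hre y)))).comp_ofReal
      simpa [div_eq_mul_inv] using this
    · apply Continuous.intervalIntegrable
      exact continuous_const.mul
        (Continuous.inv₀ (by fun_prop) fun y => hz0 _ (Or.inr (hre y).ne'))
  have hleft : I * ∫ y : ℝ in c..d, (a + y * I - w)⁻¹ =
      log (-(a + d * I - w)) - log (-(a + c * I - w)) := by
    have hre : ∀ y : ℝ, 0 < (-(a + y * I - w) : ℂ).re := by intro y; simpa using ha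
    rw [← intervalIntegral.integral_const_mul]
    refine intervalIntegral.integral_eq_sub_of_hasDerivAt
      (f := fun y : ℝ => log (-(a + y * I - w))) (fun y _ => ?_) ?_
    · have h1 : HasDerivAt (fun z : ℂ => -(a + z * I - w)) (-I) (y : ℂ) := by
        have := ((((hasDerivAt_id (y : ℂ)).mul_const I).const_add (a : ℂ)).sub_const w).neg
        rwa [one_mul] at this
      have := (h1.clog (hslit _ (Or.inr (hre y)))).comp_ofReal
      rw [neg_div_neg_eq] at this
      simpa [div_eq_mul_inv] using this
    · apply Continuous.intervalIntegrable
      refine continuous_const.mul (Continuous.inv₀ (by fun_prop) fun y => hz0 _ (Or.inr ?_))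
      have := hre y
      rw [neg_re] at this
      linarith
  unfold rectIntegral
  rw [hor c hc.ne, hor d hd.ne', hright, hleft, log_neg_eq_of_im_pos (z := a + d * I - w)
    (by simpa using hd), log_neg_eq_of_im_neg (z := a + c * I - w) (by simpa using hc)]
  ring

/-- Cauchy's integral formula for a rectangle. -/
theorem rectIntegral_div_sub {w : ℂ} (ha : a < w.re) (hb : w.re < b) (hc : c < w.im)
    (hd : w.im < d) (hf : DifferentiableOn ℂ f (Set.Icc a b ×ℂ Set.Icc c d)) :
    rectIntegral (fun s => f s / (s - w)) a b c d = 2 * Real.pi * I * f w := by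
  have hab : a ≤ b := by linarith
  have hcd : c ≤ d := by linarith
  have hsub : rectBoundary a b c d ⊆ Set.Icc a b ×ℂ Set.Icc c d := fun s hs => ⟨hs.1, hs.2.1⟩
  have hne : ∀ s ∈ rectBoundary a b c d, s - w ≠ 0 := by
    intro s hs h0
    rw [sub_eq_zero] at h0
    subst h0
    rcases hs.2.2 with h | h | h | h <;> linarith
  have hnhds : Set.Icc a b ×ℂ Set.Icc c d ∈ nhds w := by
    rw [← mem_interior_iff_mem_nhds, interior_reProdIm, interior_Icc, interior_Icc]
    exact ⟨⟨ha, hb⟩, ⟨hc, hd⟩⟩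
  have hdd : DifferentiableOn ℂ (dslope f w) (Set.Icc a b ×ℂ Set.Icc c d) :=
    (Complex.differentiableOn_dslope hnhds).mpr hf
  have hinv : ContinuousOn (fun s => f w * (s - w)⁻¹) (rectBoundary a b c d) :=
    continuousOn_const.mul (ContinuousOn.inv₀ (by fun_prop) hne)
  calc rectIntegral (fun s => f s / (s - w)) a b c d
      = rectIntegral (fun s => dslope f w s + f w * (s - w)⁻¹) a b c d := by
        refine rectIntegral_congr hab hcd fun s hs => ?_
        have h0 := hne s hs
        simp only [dslope_of_ne f (sub_ne_zero.mp h0), slope_def_field]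
        field_simp
        ring
    _ = _ := by
        rw [rectIntegral_add hab hcd (hdd.continuousOn.mono hsub) hinv,
          rectIntegral_eq_zero hab hcd hdd, rectIntegral_const_mul,
          rectIntegral_inv_sub ha hb hc hd]
        ring

end Rectangle

/-! ### The contour integral of the logarithmic derivative -/

theorem logDeriv_riemannZeta {s : ℂ} (hs : s ≠ 1) (h0 : riemannZeta s ≠ 0) :
    logDeriv riemannZeta s = logDeriv riemannZeta₁ s - 1 / (s - 1) := by
  have hs' := sub_ne_zero.mpr hs
  have hF : riemannZeta₁ s ≠ 0 := fun h => h0 (riemannZeta₁_eq_zero_iff.mp h)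
  rw [logDeriv_apply, logDeriv_apply, deriv_riemannZeta_eq_neg_inv_sub_sq_mul_add hs,
    riemannZeta_eq_inv_sub_mul hs]
  field_simp
  ring

theorem logDeriv_riemannZeta₁_zero :
    logDeriv riemannZeta₁ 0 = ((Real.log (2 * Real.pi) : ℝ) : ℂ) - 1 := by
  have h0 : riemannZeta 0 ≠ 0 := by rw [riemannZeta_zero]; norm_num
  have h1 := logDeriv_riemannZeta zero_ne_one h0
  rw [logDeriv_apply, deriv_riemannZeta_zero, riemannZeta_zero] at h1
  have h2 : logDeriv riemannZeta₁ 0 = log (2 * Real.pi) - 1 := by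
    linear_combination -h1
  rw [h2, ofReal_log Real.two_pi_pos.le]
  push_cast; rfl

/-- Cauchy's theorem for `-ζ'/ζ(s) x ^ s / s`: the residues are `x` at `1`, `-x ^ ρ / ρ` at the
nontrivial zeros and `-log (2 π)` at `0`. -/
theorem rectIntegral_neg_logDeriv_riemannZeta {x c H : ℝ} (hx : 0 < x) (hc : 1 < c) (hH : 0 < H)
    (hzero : ∀ ρ : ℂ, riemannZeta ρ = 0 → |ρ.im| ≠ H) :
    rectIntegral (fun s => -logDeriv riemannZeta s * (x : ℂ) ^ s / s) (-(1 / 4)) c (-H) H =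
      2 * Real.pi * I * (x - zeroSum x H - (Real.log (2 * Real.pi) : ℝ)) := by
  set S : Finset ℂ := (nontrivialZerosUpTo_finite H).toFinset
  set m : ℂ → ℕ := analyticOrderNatAt riemannZeta₁
  have hS : ∀ ρ, ρ ∈ S ↔ riemannZeta ρ = 0 ∧ 0 < ρ.re ∧ ρ.re < 1 ∧ |ρ.im| ≤ H := by
    intro ρ; simp [S, nontrivialZerosUpTo]
  have hS0 : ∀ ρ ∈ S, ρ ≠ 0 := by
    intro ρ hρ h; rw [hS, h] at hρ; simp at hρ
  obtain ⟨g, hg, hgS, hFg⟩ := exists_entire_eq_prod_mul differentiable_riemannZeta₁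
    exists_riemannZeta₁_ne_zero S
  have hcl : ∀ s : ℂ, -(1 / 4) ≤ s.re → |s.im| ≤ H → riemannZeta s = 0 → s ∈ S := by
    intro s h1 h2 h3
    obtain ⟨h4, h5⟩ := re_mem_Ioo_of_riemannZeta_eq_zero h3 (Or.inr (by linarith))
    exact (hS s).mpr ⟨h3, h4, h5, h2⟩
  have hgne : ∀ s ∈ Set.Icc (-(1 / 4)) c ×ℂ Set.Icc (-H) H, g s ≠ 0 := by
    intro s hs h0
    have h1 : riemannZeta₁ s = 0 := by rw [hFg, h0, mul_zero]
    have h2 : s ∈ S := hcl s hs.1.1 (abs_le.mpr hs.2) (riemannZeta₁_eq_zero_iff.mp h1)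
    exact hgS s h2 h0
  have hlogg : DifferentiableOn ℂ (logDeriv g) (Set.Icc (-(1 / 4)) c ×ℂ Set.Icc (-H) H) := by
    intro s hs
    exact ((hg.deriv s).div (hg s) (hgne s hs)).differentiableWithinAt
  have hx0 : (x : ℂ) ≠ 0 := by exact_mod_cast hx.ne'
  have he : Differentiable ℂ fun s : ℂ => (x : ℂ) ^ s := fun s =>
    DifferentiableAt.const_cpow differentiableAt_id (Or.inl hx0)
  have hsub : rectBoundary (-(1 / 4)) c (-H) H ⊆ Set.Icc (-(1 / 4)) c ×ℂ Set.Icc (-H) H :=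
    fun s hs => ⟨hs.1, hs.2.1⟩
  have hbS : ∀ s ∈ rectBoundary (-(1 / 4)) c (-H) H, s ∉ S := by
    intro s hs hsS
    obtain ⟨h1, h2, h3, h4⟩ := (hS s).mp hsS
    rcases hs.2.2 with h | h | h | h
    · linarith
    · linarith
    · exact hzero s h1 (by rw [h, abs_neg, abs_of_pos hH])
    · exact hzero s h1 (by rw [h, abs_of_pos hH])
  have hb0 : ∀ s ∈ rectBoundary (-(1 / 4)) c (-H) H, s ≠ 0 := by
    rintro s hs rfl
    rcases hs.2.2 with h | h | h | h <;> simp at h <;> linarith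
  have hb1 : ∀ s ∈ rectBoundary (-(1 / 4)) c (-H) H, s ≠ 1 := by
    rintro s hs rfl
    rcases hs.2.2 with h | h | h | h <;> simp at h <;> linarith
  have hcont : ∀ w : ℂ, (∀ s ∈ rectBoundary (-(1 / 4)) c (-H) H, s ≠ w) →
      ContinuousOn (fun s : ℂ => (x : ℂ) ^ s / (s - w)) (rectBoundary (-(1 / 4)) c (-H) H) :=
    fun w hw => he.continuous.continuousOn.div (by fun_prop)
      fun s hs => sub_ne_zero.mpr (hw s hs)
  have hbw : ∀ ρ ∈ S, ∀ s ∈ rectBoundary (-(1 / 4)) c (-H) H, s ≠ ρ := by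
    rintro ρ hρ s hs rfl
    exact hbS s hs hρ
  have hT : ∀ ρ ∈ S, ContinuousOn (fun s : ℂ => -(m ρ / ρ : ℂ) * ((x : ℂ) ^ s / (s - ρ)))
      (rectBoundary (-(1 / 4)) c (-H) H) := fun ρ hρ =>
    continuousOn_const.mul (hcont ρ (hbw ρ hρ))
  have hlast : ContinuousOn (fun s : ℂ => -1 * (logDeriv g s * (x : ℂ) ^ s / (s - 0)))
      (rectBoundary (-(1 / 4)) c (-H) H) :=
    continuousOn_const.mul (((hlogg.continuousOn.mono hsub).mul he.continuous.continuousOn).div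
      (by fun_prop) fun s hs => sub_ne_zero.mpr (hb0 s hs))
  have hab : -(1 / 4) ≤ c := by linarith
  have hcd : -H ≤ H := by linarith
  set A : ℂ := -1 + ∑ ρ ∈ S, (m ρ / ρ : ℂ)
  -- partial fractions turn the integrand into a combination of Cauchy kernels
  have hdecomp : rectIntegral (fun s => -logDeriv riemannZeta s * (x : ℂ) ^ s / s)
        (-(1 / 4)) c (-H) H =
      rectIntegral (fun s => (x : ℂ) ^ s / (s - 1) + (A * ((x : ℂ) ^ s / (s - 0)) +
        (∑ ρ ∈ S, -(m ρ / ρ : ℂ) * ((x : ℂ) ^ s / (s - ρ)) +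
          -1 * (logDeriv g s * (x : ℂ) ^ s / (s - 0))))) (-(1 / 4)) c (-H) H := by
    refine rectIntegral_congr hab hcd fun s hs => ?_
    have hs0 := hb0 s hs
    have hs1 := sub_ne_zero.mpr (hb1 s hs)
    have hζ : riemannZeta s ≠ 0 := fun h =>
      hbS s hs (hcl s hs.1.1 (abs_le.mpr hs.2.1) h)
    have hl := logDeriv_eq_sum_add_logDeriv hg hFg (fun ρ hρ => hbw ρ hρ s hs) (hgne s (hsub hs))
    rw [logDeriv_riemannZeta (hb1 s hs) hζ, hl]
    have hsum : ∑ ρ ∈ S, -(m ρ / ρ : ℂ) * ((x : ℂ) ^ s / (s - ρ)) =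
        -(∑ ρ ∈ S, (m ρ : ℂ) / (s - ρ)) * (x : ℂ) ^ s / s -
          (∑ ρ ∈ S, (m ρ / ρ : ℂ)) * ((x : ℂ) ^ s / s) := by
      simp only [← Finset.sum_neg_distrib, Finset.sum_mul, Finset.sum_div,
        ← Finset.sum_sub_distrib]
      refine Finset.sum_congr rfl fun ρ hρ => ?_
      have h1 := sub_ne_zero.mpr (hbw ρ hρ s hs)
      have h2 := hS0 ρ hρ
      field_simp
      ring
    rw [hsum]
    simp only [A, sub_zero]
    field_simp
    ring
  have hA0 : ContinuousOn (fun s : ℂ => A * ((x : ℂ) ^ s / (s - 0)))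
      (rectBoundary (-(1 / 4)) c (-H) H) := continuousOn_const.mul (hcont 0 hb0)
  have hTS : ContinuousOn (fun s : ℂ => ∑ ρ ∈ S, -(m ρ / ρ : ℂ) * ((x : ℂ) ^ s / (s - ρ)))
      (rectBoundary (-(1 / 4)) c (-H) H) := continuousOn_finsetSum S hT
  rw [hdecomp, rectIntegral_add hab hcd (hcont 1 hb1) (hA0.fun_add (hTS.fun_add hlast)),
    rectIntegral_add hab hcd hA0 (hTS.fun_add hlast), rectIntegral_add hab hcd hTS hlast,
    rectIntegral_sum hab hcd S hT, rectIntegral_const_mul, rectIntegral_const_mul,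
    rectIntegral_div_sub (by norm_num) (by simpa using hc) (by simpa using hH)
      (by simpa using hH) he.differentiableOn,
    rectIntegral_div_sub (by norm_num) (by simp; linarith) (by simpa using hH)
      (by simpa using hH) he.differentiableOn,
    rectIntegral_div_sub (f := fun s => logDeriv g s * (x : ℂ) ^ s) (by norm_num)
      (by simp; linarith) (by simpa using hH) (by simpa using hH) (hlogg.mul he.differentiableOn)]
  have hsum : ∑ ρ ∈ S, rectIntegral (fun s => -(m ρ / ρ : ℂ) * ((x : ℂ) ^ s / (s - ρ)))
      (-(1 / 4)) c (-H) H = -(2 * Real.pi * I * zeroSum x H) := by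
    unfold zeroSum
    rw [Finset.mul_sum, ← Finset.sum_neg_distrib]
    refine Finset.sum_congr rfl fun ρ hρ => ?_
    obtain ⟨h1, h2, h3, h4⟩ := (hS ρ).mp hρ
    have h5 := abs_lt.mp (lt_of_le_of_ne h4 (hzero ρ h1))
    rw [rectIntegral_const_mul, rectIntegral_div_sub (by linarith) (by linarith) h5.1 h5.2
      he.differentiableOn, ← analyticOrderNatAt_riemannZeta₁ (by rintro rfl; simp at h3)]
    ring
  have hF0 := logDeriv_eq_sum_add_logDeriv hg hFg (s := 0) (fun ρ hρ => (hS0 ρ hρ).symm)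
    (hgne 0 ⟨by simp; linarith, by simp; linarith⟩)
  rw [logDeriv_riemannZeta₁_zero] at hF0
  have hA : A = -1 - ∑ ρ ∈ S, (m ρ : ℂ) / (0 - ρ) := by
    simp only [A, zero_sub, div_neg, Finset.sum_neg_distrib, sub_neg_eq_add]
  rw [hsum, hA]
  simp only [cpow_one, cpow_zero]
  linear_combination (2 * Real.pi * I) * hF0

/-! ### The truncated Perron kernel -/

theorem integral_const_rpow {y : ℝ} (hy : 0 < y) (hy1 : y ≠ 1) (a b : ℝ) :
    ∫ σ : ℝ in a..b, y ^ σ = (y ^ b - y ^ a) / Real.log y := by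
  have hlog : Real.log y ≠ 0 := Real.log_ne_zero_of_pos_of_ne_one hy hy1
  rw [sub_div]
  refine intervalIntegral.integral_eq_sub_of_hasDerivAt (f := fun σ => y ^ σ / Real.log y)
    (fun σ _ => ?_) ((Real.continuous_const_rpow hy.ne').intervalIntegrable a b)
  have := (Real.hasStrictDerivAt_const_rpow hy σ).hasDerivAt.div_const (Real.log y)
  rwa [mul_div_cancel_right₀ _ hlog] at this

theorem norm_ofReal_cpow_add_mul_I {y : ℝ} (hy : 0 < y) (σ t : ℝ) :
    ‖(y : ℂ) ^ (σ + t * I : ℂ)‖ = y ^ σ := by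
  rw [norm_cpow_eq_rpow_re_of_pos hy]; simp

theorem norm_add_mul_I_ge_abs_im (σ t : ℝ) : |t| ≤ ‖(σ + t * I : ℂ)‖ := by
  simpa using abs_im_le_norm (σ + t * I : ℂ)

theorem norm_add_mul_I_ge_abs_re (σ t : ℝ) : |σ| ≤ ‖(σ + t * I : ℂ)‖ := by
  simpa using abs_re_le_norm (σ + t * I : ℂ)

theorem continuous_cpow_vertical {y : ℝ} (hy : 0 < y) (σ : ℝ) :
    Continuous fun t : ℝ => (y : ℂ) ^ (σ + t * I : ℂ) :=
  Continuous.const_cpow (by fun_prop) (Or.inl (by exact_mod_cast hy.ne'))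

/-- Integrals along horizontal segments of a function of size `B y ^ σ`. -/
theorem norm_integral_horizontal_le {y B a b t : ℝ} (hy : 0 < y) (hy1 : y ≠ 1) (hab : a ≤ b)
    {f : ℂ → ℂ} (hf : ∀ σ ∈ Set.Ioc a b, ‖f (σ + t * I)‖ ≤ B * y ^ σ) :
    ‖∫ σ : ℝ in a..b, f (σ + t * I)‖ ≤ B * ((y ^ b - y ^ a) / Real.log y) := by
  rw [← integral_const_rpow hy hy1, ← intervalIntegral.integral_const_mul]
  exact intervalIntegral.norm_integral_le_of_norm_le hab
    (Filter.Eventually.of_forall hf)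
    ((continuous_const.mul (Real.continuous_const_rpow hy.ne')).intervalIntegrable a b)

theorem norm_cpow_div_horizontal_le {y t σ : ℝ} (hy : 0 < y) (ht : t ≠ 0) :
    ‖(y : ℂ) ^ (σ + t * I : ℂ) / (σ + t * I : ℂ)‖ ≤ 1 / |t| * y ^ σ := by
  rw [norm_div, norm_ofReal_cpow_add_mul_I hy, one_div, inv_mul_eq_div]
  have := norm_add_mul_I_ge_abs_im σ t
  have := abs_pos.mpr ht
  gcongr

theorem norm_cpow_div_vertical_le {y t σ : ℝ} (hy : 0 < y) (hσ : 1 ≤ |σ|) :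
    ‖(y : ℂ) ^ (σ + t * I : ℂ) / (σ + t * I : ℂ)‖ ≤ y ^ σ := by
  rw [norm_div, norm_ofReal_cpow_add_mul_I hy]
  have := norm_add_mul_I_ge_abs_re σ t
  exact div_le_self (by positivity) (hσ.trans this)

/-- The truncated Perron integral of `y ^ s / s` along the segment from `c - i H` to `c + i H`. -/
noncomputable def perronKernel (c H y : ℝ) : ℂ :=
  1 / (2 * Real.pi) * ∫ t : ℝ in (-H)..H, (y : ℂ) ^ (c + t * I : ℂ) / (c + t * I : ℂ)

/-- For `y < 1` the segment is moved to the right, where `y ^ s` tends to `0`. -/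
theorem norm_perronKernel_le_of_lt_one {c H y : ℝ} (hc : 1 ≤ c) (hH : 0 < H) (hy : 0 < y)
    (hy1 : y < 1) : ‖perronKernel c H y‖ ≤ y ^ c / (Real.pi * H * |Real.log y|) := by
  have hlog : Real.log y < 0 := Real.log_neg hy hy1
  have hpi := Real.pi_pos
  set J := ∫ t : ℝ in (-H)..H, (y : ℂ) ^ (c + t * I : ℂ) / (c + t * I : ℂ)
  -- `U` is the abscissa of the right side of the rectangle, to be sent to `∞`
  have hU : ∀ U : ℝ, c ≤ U → ‖J‖ ≤ 2 * (1 / H * (y ^ c / -Real.log y)) + 2 * H * y ^ U := by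
    intro U hU
    have hd : DifferentiableOn ℂ (fun s : ℂ => (y : ℂ) ^ s / s)
        (Set.Icc c U ×ℂ Set.Icc (-H) H) := by
      intro s hs
      have hs0 : s ≠ 0 := by
        rintro rfl
        have := hs.1.1
        simp at this
        linarith
      refine DifferentiableAt.differentiableWithinAt
        (DifferentiableAt.div ?_ differentiableAt_id hs0)
      exact DifferentiableAt.const_cpow differentiableAt_id (Or.inl (by exact_mod_cast hy.ne'))
    have h0 := rectIntegral_eq_zero hU (by linarith : -H ≤ H) hd
    unfold rectIntegral at h0
    have hhor : ∀ t : ℝ, |t| = H →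
        ‖∫ σ : ℝ in c..U, (y : ℂ) ^ (σ + t * I : ℂ) / (σ + t * I : ℂ)‖ ≤
          1 / H * (y ^ c / -Real.log y) := by
      intro t ht
      refine (norm_integral_horizontal_le (B := 1 / H) (f := fun s => (y : ℂ) ^ s / s) hy hy1.ne hU
        fun σ _ => ?_).trans ?_
      · rw [← ht]
        exact norm_cpow_div_horizontal_le hy (by rintro rfl; simp at ht; linarith)
      · rw [show (y ^ U - y ^ c) / Real.log y = (y ^ c - y ^ U) / -Real.log y by
          rw [div_neg, ← neg_div]; ring]
        have : 0 < y ^ U := Real.rpow_pos_of_pos hy U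
        have : 0 < -Real.log y := by linarith
        gcongr
        linarith
    have hver : ‖∫ t : ℝ in (-H)..H, (y : ℂ) ^ (U + t * I : ℂ) / (U + t * I : ℂ)‖ ≤
        2 * H * y ^ U := by
      have := intervalIntegral.norm_integral_le_of_norm_le_const (a := -H) (b := H) (C := y ^ U)
        (f := fun t : ℝ => (y : ℂ) ^ (U + t * I : ℂ) / (U + t * I : ℂ))
        (fun t _ => norm_cpow_div_vertical_le hy ((hc.trans hU).trans (le_abs_self U)))
      rw [sub_neg_eq_add, abs_of_pos (by linarith)] at this
      linarith
    have h1 := hhor (-H) (by rw [abs_neg, abs_of_pos hH])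
    have h2 := hhor H (abs_of_pos hH)
    set X1 := ∫ σ : ℝ in c..U, (y : ℂ) ^ (σ + (-H : ℝ) * I : ℂ) / (σ + (-H : ℝ) * I : ℂ)
    set X2 := ∫ σ : ℝ in c..U, (y : ℂ) ^ (σ + H * I : ℂ) / (σ + H * I : ℂ)
    set X3 := ∫ t : ℝ in (-H)..H, (y : ℂ) ^ (U + t * I : ℂ) / (U + t * I : ℂ)
    have h3 : I * J = X1 - X2 + I * X3 := by linear_combination -h0
    calc ‖J‖ = ‖I * J‖ := by simp
      _ = ‖X1 - X2 + I * X3‖ := by rw [h3]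
      _ ≤ ‖X1‖ + ‖X2‖ + ‖I * X3‖ := (norm_add_le _ _).trans (by gcongr; exact norm_sub_le _ _)
      _ = ‖X1‖ + ‖X2‖ + ‖X3‖ := by simp
      _ ≤ _ := by linarith
  have hlim : Filter.Tendsto (fun U : ℝ => 2 * (1 / H * (y ^ c / -Real.log y)) + 2 * H * y ^ U)
      Filter.atTop (nhds (2 * (1 / H * (y ^ c / -Real.log y)) + 2 * H * 0)) :=
    ((tendsto_rpow_atTop_of_base_lt_one y (by linarith) hy1).const_mul _).const_add _
  have hJ := ge_of_tendsto hlim (Filter.eventually_atTop.mpr ⟨c, hU⟩)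
  rw [mul_zero, add_zero] at hJ
  unfold perronKernel
  rw [norm_mul, abs_of_neg hlog]
  have : ‖(1 / (2 * Real.pi) : ℂ)‖ = 1 / (2 * Real.pi) := by simp [abs_of_pos hpi]
  rw [this]
  calc _ ≤ 1 / (2 * Real.pi) * (2 * (1 / H * (y ^ c / -Real.log y))) := by gcongr
    _ = _ := by
      have : Real.log y ≠ 0 := hlog.ne
      field_simp

/-- For `1 < y` the segment is moved to the left, past the pole at `0`, whose residue is `1`. -/
theorem norm_perronKernel_sub_one_le_of_one_lt {c H y : ℝ} (hc : 1 ≤ c) (hH : 0 < H)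
    (hy1 : 1 < y) : ‖perronKernel c H y - 1‖ ≤ y ^ c / (Real.pi * H * |Real.log y|) := by
  have hy : 0 < y := by linarith
  have hlog : 0 < Real.log y := Real.log_pos hy1
  have hpi := Real.pi_pos
  set J := ∫ t : ℝ in (-H)..H, (y : ℂ) ^ (c + t * I : ℂ) / (c + t * I : ℂ)
  -- `U` is the abscissa of the left side of the rectangle, to be sent to `-∞`
  have hU : ∀ U : ℝ, U ≤ -1 →
      ‖J - 2 * Real.pi‖ ≤ 2 * (1 / H * (y ^ c / Real.log y)) + 2 * H * y ^ U := by
    intro U hU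
    have hUc : U ≤ c := by linarith
    have hd : Differentiable ℂ (fun s : ℂ => (y : ℂ) ^ s) := fun s =>
      DifferentiableAt.const_cpow differentiableAt_id (Or.inl (by exact_mod_cast hy.ne'))
    have h0 := rectIntegral_div_sub (a := U) (b := c) (c := -H) (d := H) (w := 0)
      (by simp; linarith) (by simp; linarith) (by simpa using hH) (by simpa using hH)
      hd.differentiableOn
    unfold rectIntegral at h0
    simp only [sub_zero, cpow_zero, mul_one] at h0
    have hhor : ∀ t : ℝ, |t| = H →
        ‖∫ σ : ℝ in U..c, (y : ℂ) ^ (σ + t * I : ℂ) / (σ + t * I : ℂ)‖ ≤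
          1 / H * (y ^ c / Real.log y) := by
      intro t ht
      refine (norm_integral_horizontal_le (B := 1 / H) (f := fun s => (y : ℂ) ^ s / s) hy hy1.ne'
        hUc fun σ _ => ?_).trans ?_
      · rw [← ht]
        exact norm_cpow_div_horizontal_le hy (by rintro rfl; simp at ht; linarith)
      · have : 0 < y ^ U := Real.rpow_pos_of_pos hy U
        gcongr
        linarith
    have hver : ‖∫ t : ℝ in (-H)..H, (y : ℂ) ^ (U + t * I : ℂ) / (U + t * I : ℂ)‖ ≤
        2 * H * y ^ U := by
      have := intervalIntegral.norm_integral_le_of_norm_le_const (a := -H) (b := H) (C := y ^ U)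
        (f := fun t : ℝ => (y : ℂ) ^ (U + t * I : ℂ) / (U + t * I : ℂ))
        (fun t _ => norm_cpow_div_vertical_le hy (by rw [le_abs]; right; linarith))
      rw [sub_neg_eq_add, abs_of_pos (by linarith)] at this
      linarith
    have h1 := hhor (-H) (by rw [abs_neg, abs_of_pos hH])
    have h2 := hhor H (abs_of_pos hH)
    set X1 := ∫ σ : ℝ in U..c, (y : ℂ) ^ (σ + (-H : ℝ) * I : ℂ) / (σ + (-H : ℝ) * I : ℂ)
    set X2 := ∫ σ : ℝ in U..c, (y : ℂ) ^ (σ + H * I : ℂ) / (σ + H * I : ℂ)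
    set X3 := ∫ t : ℝ in (-H)..H, (y : ℂ) ^ (U + t * I : ℂ) / (U + t * I : ℂ)
    have h3 : I * (J - 2 * Real.pi) = X2 - X1 + I * X3 := by linear_combination h0
    calc ‖J - 2 * Real.pi‖ = ‖I * (J - 2 * Real.pi)‖ := by simp
      _ = ‖X2 - X1 + I * X3‖ := by rw [h3]
      _ ≤ ‖X2‖ + ‖X1‖ + ‖I * X3‖ := (norm_add_le _ _).trans (by gcongr; exact norm_sub_le _ _)
      _ = ‖X2‖ + ‖X1‖ + ‖X3‖ := by simp
      _ ≤ _ := by linarith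
  have hlim : Filter.Tendsto (fun U : ℝ => 2 * (1 / H * (y ^ c / Real.log y)) + 2 * H * y ^ U)
      Filter.atBot (nhds (2 * (1 / H * (y ^ c / Real.log y)) + 2 * H * 0)) :=
    ((tendsto_rpow_atBot_of_base_gt_one y hy1).const_mul _).const_add _
  have hJ := ge_of_tendsto hlim (Filter.eventually_atBot.mpr ⟨-1, hU⟩)
  rw [mul_zero, add_zero] at hJ
  have hpi' : (Real.pi : ℂ) ≠ 0 := by exact_mod_cast hpi.ne'
  have hk : perronKernel c H y - 1 = 1 / (2 * Real.pi) * (J - 2 * Real.pi) := by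
    unfold perronKernel
    field_simp
    rfl
  rw [hk, norm_mul, abs_of_pos hlog]
  have : ‖(1 / (2 * Real.pi) : ℂ)‖ = 1 / (2 * Real.pi) := by simp [abs_of_pos hpi]
  rw [this]
  calc _ ≤ 1 / (2 * Real.pi) * (2 * (1 / H * (y ^ c / Real.log y))) := by gcongr
    _ = _ := by field_simp

theorem integral_inv_norm_vertical_le {σ H : ℝ} (hσ : σ ≠ 0) (hH : 1 ≤ H) :
    ∫ t : ℝ in (-H)..H, ‖(σ + t * I : ℂ)‖⁻¹ ≤ 2 * (1 / |σ| + Real.log H) := by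
  have hpos : ∀ t : ℝ, 0 < ‖(σ + t * I : ℂ)‖ := fun t =>
    (abs_pos.mpr hσ).trans_le (norm_add_mul_I_ge_abs_re σ t)
  have hcont : Continuous fun t : ℝ => ‖(σ + t * I : ℂ)‖⁻¹ :=
    Continuous.inv₀ (by fun_prop) fun t => (hpos t).ne'
  have hint : ∀ a b : ℝ, IntervalIntegrable (fun t : ℝ => ‖(σ + t * I : ℂ)‖⁻¹)
      MeasureTheory.volume a b := fun a b => hcont.intervalIntegrable a b
  have hmid : ∫ t : ℝ in (-1)..1, ‖(σ + t * I : ℂ)‖⁻¹ ≤ 2 * (1 / |σ|) := by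
    have h : ∫ t : ℝ in (-1)..1, ‖(σ + t * I : ℂ)‖⁻¹ ≤ ∫ t : ℝ in (-1)..1, (1 / |σ| : ℝ) := by
      refine intervalIntegral.integral_mono_on (by norm_num) (hint _ _) (by simp) fun t _ => ?_
      rw [one_div]
      exact inv_anti₀ (abs_pos.mpr hσ) (norm_add_mul_I_ge_abs_re σ t)
    refine h.trans (le_of_eq ?_)
    rw [intervalIntegral.integral_const, smul_eq_mul]
    norm_num
  have hright : ∫ t : ℝ in (1)..H, ‖(σ + t * I : ℂ)‖⁻¹ ≤ Real.log H := by
    have h : ∫ t : ℝ in (1)..H, ‖(σ + t * I : ℂ)‖⁻¹ ≤ ∫ t : ℝ in (1)..H, t⁻¹ := by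
      refine intervalIntegral.integral_mono_on hH (hint _ _) ?_ fun t ht => ?_
      · refine intervalIntegral.intervalIntegrable_inv (fun t ht => ?_) (by fun_prop)
        rw [Set.uIcc_of_le hH] at ht
        linarith [ht.1]
      · have h0 : 0 < t := by linarith [ht.1]
        exact inv_anti₀ h0 ((le_abs_self t).trans (norm_add_mul_I_ge_abs_im σ t))
    refine h.trans (le_of_eq ?_)
    rw [integral_inv_of_pos one_pos (by linarith), div_one]
  have hleft : ∫ t : ℝ in (-H)..(-1), ‖(σ + t * I : ℂ)‖⁻¹ =
      ∫ t : ℝ in (1)..H, ‖(σ + t * I : ℂ)‖⁻¹ := by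
    rw [← intervalIntegral.integral_comp_neg]
    refine intervalIntegral.integral_congr fun t _ => ?_
    have : (σ + (-t : ℝ) * I : ℂ) = conj (σ + t * I : ℂ) := by simp
    simp only [this, norm_conj]
  rw [← intervalIntegral.integral_add_adjacent_intervals (hint (-H) (-1)) (hint (-1) H),
    ← intervalIntegral.integral_add_adjacent_intervals (hint (-1) 1) (hint 1 H), hleft]
  linarith

/-- The trivial bound for the kernel, for `y` close to `1` where the other bounds blow up. -/
theorem norm_perronKernel_le {c H y : ℝ} (hc : 1 ≤ c) (hH : 1 ≤ H) (hy : 0 < y) :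
    ‖perronKernel c H y‖ ≤ y ^ c * (1 + Real.log H) / Real.pi := by
  have hpi := Real.pi_pos
  have hJ : ‖∫ t : ℝ in (-H)..H, (y : ℂ) ^ (c + t * I : ℂ) / (c + t * I : ℂ)‖ ≤
      y ^ c * (2 * (1 / |c| + Real.log H)) := by
    have h := integral_inv_norm_vertical_le (σ := c) (by linarith) hH
    have hpos : ∀ t : ℝ, 0 < ‖(c + t * I : ℂ)‖ := fun t =>
      (abs_pos.mpr (by linarith)).trans_le (norm_add_mul_I_ge_abs_re c t)
    have hcont : Continuous fun t : ℝ => ‖(c + t * I : ℂ)‖⁻¹ :=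
      Continuous.inv₀ (by fun_prop) fun t => (hpos t).ne'
    have h1 := intervalIntegral.norm_integral_le_of_norm_le (a := -H) (b := H)
      (f := fun t : ℝ => (y : ℂ) ^ (c + t * I : ℂ) / (c + t * I : ℂ))
      (g := fun t : ℝ => y ^ c * ‖(c + t * I : ℂ)‖⁻¹) (μ := MeasureTheory.volume) (by linarith)
      (Filter.Eventually.of_forall fun t _ => by
        rw [norm_div, norm_ofReal_cpow_add_mul_I hy, div_eq_mul_inv])
      ((continuous_const.mul hcont).intervalIntegrable _ _)
    rw [intervalIntegral.integral_const_mul] at h1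
    refine h1.trans ?_
    have := Real.rpow_pos_of_pos hy c
    gcongr
  have h1c : 1 / |c| ≤ 1 := by
    rw [abs_of_pos (by linarith)]
    exact (div_le_one (by linarith)).mpr hc
  have hnorm : ‖(1 / (2 * Real.pi) : ℂ)‖ = 1 / (2 * Real.pi) := by simp [abs_of_pos hpi]
  unfold perronKernel
  rw [norm_mul, hnorm]
  have := Real.rpow_pos_of_pos hy c
  calc _ ≤ 1 / (2 * Real.pi) * (y ^ c * (2 * (1 + Real.log H))) := by
        refine mul_le_mul_of_nonneg_left (hJ.trans ?_) (by positivity)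
        gcongr
    _ = _ := by field_simp

/-! ### The Dirichlet series of the logarithmic derivative -/

open ArithmeticFunction in
theorem summable_vonMangoldt_div_rpow {c : ℝ} (hc : 1 < c) :
    Summable fun n : ℕ => Λ n / (n : ℝ) ^ c := by
  have h := (LSeriesSummable_vonMangoldt (s := (c : ℂ)) (by simpa using hc)).norm
  refine h.congr fun n => ?_
  rcases Nat.eq_zero_or_pos n with rfl | hn
  · simp [LSeries.term]
  · rw [LSeries.term_of_ne_zero hn.ne', norm_div, norm_natCast_cpow_of_pos hn]
    simp [abs_of_nonneg (vonMangoldt_nonneg (n := n))]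

open ArithmeticFunction in
theorem hasSum_vonMangoldt_cpow {s : ℂ} (hs : 1 < s.re) {x : ℝ} (hx : 0 < x) :
    HasSum (fun n : ℕ => (Λ n : ℂ) * ((x / n : ℝ) : ℂ) ^ s)
      (-logDeriv riemannZeta s * (x : ℂ) ^ s) := by
  have h := (LSeriesSummable_vonMangoldt hs).hasSum
  rw [show ∑' n, LSeries.term (fun n => (Λ n : ℂ)) s n = LSeries (fun n => (Λ n : ℂ)) s from rfl,
    LSeries_vonMangoldt_eq_deriv_riemannZeta_div hs] at h
  have h2 := h.mul_right ((x : ℂ) ^ s)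
  rw [logDeriv_apply, ← neg_div]
  refine h2.congr_fun fun n => ?_
  rcases Nat.eq_zero_or_pos n with rfl | hn
  · simp [LSeries.term]
  · have hn' : (0 : ℝ) < n := by exact_mod_cast hn
    have hns : (n : ℂ) ^ s ≠ 0 := by
      rw [cpow_ne_zero_iff]; left; exact_mod_cast hn.ne'
    have h3 : (x : ℂ) ^ s = ((x / n : ℝ) : ℂ) ^ s * (n : ℂ) ^ s := by
      have := mul_cpow_ofReal_nonneg (div_pos hx hn').le hn'.le s
      rw [← ofReal_mul, div_mul_cancel₀ _ hn'.ne', ofReal_natCast] at this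
      exact this
    rw [LSeries.term_of_ne_zero hn.ne', h3]
    field_simp

theorem summable_vonMangoldt_mul_rpow {c x : ℝ} (hc : 1 < c) (hx : 0 < x) :
    Summable fun n : ℕ => ArithmeticFunction.vonMangoldt n * (x / n) ^ c := by
  refine ((summable_vonMangoldt_div_rpow hc).mul_left (x ^ c)).congr fun n => ?_
  rw [Real.div_rpow hx.le (Nat.cast_nonneg n)]
  ring

/-- Perron's formula for `-ζ'/ζ`, before the kernel is evaluated. -/
theorem hasSum_vonMangoldt_mul_perronKernel {c H x : ℝ} (hc : 1 < c) (hx : 0 < x) :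
    HasSum (fun n : ℕ => (ArithmeticFunction.vonMangoldt n : ℂ) * perronKernel c H (x / n))
      (1 / (2 * Real.pi) * ∫ t : ℝ in (-H)..H,
        -logDeriv riemannZeta (c + t * I) * (x : ℂ) ^ (c + t * I : ℂ) / (c + t * I : ℂ)) := by
  have hne : ∀ t : ℝ, (c + t * I : ℂ) ≠ 0 := by
    intro t h
    have := congrArg re h
    simp at this
    linarith
  have hbd : ∀ (n : ℕ) (t : ℝ), ‖(ArithmeticFunction.vonMangoldt n : ℂ) *
      ((x / n : ℝ) : ℂ) ^ (c + t * I : ℂ) / (c + t * I : ℂ)‖ ≤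
        ArithmeticFunction.vonMangoldt n * (x / n) ^ c := by
    intro n t
    rcases Nat.eq_zero_or_pos n with rfl | hn
    · simp
    · rw [mul_div_assoc, norm_mul, norm_real,
        Real.norm_of_nonneg ArithmeticFunction.vonMangoldt_nonneg]
      refine mul_le_mul_of_nonneg_left ?_ ArithmeticFunction.vonMangoldt_nonneg
      exact norm_cpow_div_vertical_le (div_pos hx (by exact_mod_cast hn))
        (hc.le.trans (le_abs_self c))
  have h := intervalIntegral.hasSum_integral_of_dominated_convergence
    (μ := MeasureTheory.volume) (a := -H) (b := H)
    (F := fun (n : ℕ) (t : ℝ) => (ArithmeticFunction.vonMangoldt n : ℂ) *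
      ((x / n : ℝ) : ℂ) ^ (c + t * I : ℂ) / (c + t * I : ℂ))
    (f := fun t : ℝ => -logDeriv riemannZeta (c + t * I) * (x : ℂ) ^ (c + t * I : ℂ) /
      (c + t * I : ℂ))
    (fun n _ => ArithmeticFunction.vonMangoldt n * (x / n) ^ c)
    (fun n => by
      rcases Nat.eq_zero_or_pos n with rfl | hn
      · simpa using MeasureTheory.aestronglyMeasurable_const
      · refine Continuous.aestronglyMeasurable ?_
        exact (continuous_const.mul (continuous_cpow_vertical
          (div_pos hx (by exact_mod_cast hn)) c)).div (by fun_prop) hne)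
    (fun n => Filter.Eventually.of_forall fun t _ => hbd n t)
    (Filter.Eventually.of_forall fun t _ => summable_vonMangoldt_mul_rpow hc hx)
    (by simp)
    (Filter.Eventually.of_forall fun t _ =>
      (hasSum_vonMangoldt_cpow (s := c + t * I) (by simpa using hc) hx).div_const _)
  refine (h.mul_left (1 / (2 * Real.pi) : ℂ)).congr_fun fun n => ?_
  unfold perronKernel
  simp only [mul_div_assoc, intervalIntegral.integral_const_mul]
  ring

/-- The constant is the quotient of a Cauchy estimate for the derivative, on a circle of radius
`1`, by the lower bound `1 / 2` for the function. -/
theorem norm_logDeriv_riemannZeta₁_le_near_one {c : ℝ} (hc : 1 ≤ c) (hc2 : c ≤ 1.01) :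
    ‖logDeriv riemannZeta₁ c‖ ≤ 256 := by
  have h1 : 1 / 2 ≤ ‖riemannZeta₁ c‖ := by
    rw [riemannZeta₁_eq (by simp; linarith)]
    have hb := fun n => norm_trapezoidTerm_le n (s := (c : ℂ)) (by simp; linarith)
    have h2 := tsum_of_norm_bounded (summable_one_div_rpow_five_quarters.mul_left _).hasSum hb
    rw [tsum_mul_left] at h2
    have h5 := tsum_one_div_rpow_five_quarters_le
    have h6 : 0 ≤ ∑' n : ℕ, 1 / (n + 1 : ℝ) ^ (5 / 4 : ℝ) := tsum_nonneg fun n => by positivity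
    have e1 : ‖(c : ℂ) - 1‖ = c - 1 := by
      rw [← ofReal_one, ← ofReal_sub, norm_real, Real.norm_of_nonneg (by linarith)]
    have e2 : ‖(c : ℂ)‖ = c := by rw [norm_real, Real.norm_of_nonneg (by linarith)]
    have e3 : ‖(c : ℂ) + 1‖ = c + 1 := by
      rw [← ofReal_one, ← ofReal_add, norm_real, Real.norm_of_nonneg (by linarith)]
    rw [e1, e2, e3] at h2
    have h7 : (c - 1) * c * (c + 1) / 8 ≤ 0.01 := by
      have : (c - 1) * c * (c + 1) ≤ 0.01 * 1.01 * 2.01 := by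
        have : 0 ≤ c - 1 := by linarith
        gcongr <;> linarith
      linarith
    have h8 : ‖∑' n, trapezoidTerm n (c : ℂ)‖ ≤ 0.01 * 5 := by
      refine h2.trans ?_
      gcongr
    have h9 : ‖((c : ℂ) + 1) / 2‖ = (c + 1) / 2 := by rw [norm_div, e3]; simp
    have h10 := norm_sub_norm_le (((c : ℂ) + 1) / 2) (-∑' n, trapezoidTerm n (c : ℂ))
    rw [sub_neg_eq_add, norm_neg, h9] at h10
    linarith
  have h2 : ‖deriv riemannZeta₁ c‖ ≤ 128 / 1 := by
    refine Complex.norm_deriv_le_of_forall_mem_sphere_norm_le one_pos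
      differentiable_riemannZeta₁.diffContOnCl fun z hz => ?_
    have hz' : ‖z - c‖ = 1 := by simpa [dist_eq] using hz
    have hre : -(3 / 4) ≤ z.re := by
      have := (abs_le.mp ((abs_re_le_norm (z - c)).trans hz'.le)).1
      simp at this
      linarith
    have hn : ‖z‖ + 1 ≤ 4 := by
      have h3 : ‖z‖ ≤ ‖z - c‖ + ‖(c : ℂ)‖ := by simpa using norm_add_le (z - c) c
      rw [norm_real, Real.norm_of_nonneg (by linarith)] at h3
      linarith
    calc _ ≤ 2 * (‖z‖ + 1) ^ 3 := norm_riemannZeta₁_le hre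
      _ ≤ 2 * 4 ^ 3 := by gcongr
      _ = 128 := by norm_num
  rw [logDeriv_apply, norm_div, div_le_iff₀ (by linarith)]
  linarith

/-- The series is `x ^ c` times `-ζ'/ζ(c)`, and `-ζ'/ζ` has a simple pole with
residue `1` at `1`. -/
theorem tsum_vonMangoldt_mul_rpow_le {c x : ℝ} (hc : 1 < c) (hc2 : c ≤ 1.01) (hx : 0 < x) :
    ∑' n : ℕ, ArithmeticFunction.vonMangoldt n * (x / n) ^ c ≤
      x ^ c * (1 / (c - 1) + 256) := by
  have h := hasSum_vonMangoldt_cpow (s := (c : ℂ)) (by simpa using hc) hx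
  have hre := (summable_vonMangoldt_mul_rpow hc hx).hasSum
  have h2 : HasSum (fun n : ℕ => (ArithmeticFunction.vonMangoldt n : ℂ) *
      ((x / n : ℝ) : ℂ) ^ (c : ℂ))
      ((∑' n : ℕ, ArithmeticFunction.vonMangoldt n * (x / n) ^ c : ℝ) : ℂ) := by
    refine (hasSum_ofReal.mpr hre).congr_fun fun n => ?_
    rw [ofReal_mul, ofReal_cpow (by positivity)]
  have h3 := congrArg norm (h2.unique h)
  rw [norm_real, norm_mul, norm_neg, norm_cpow_eq_rpow_re_of_pos hx, ofReal_re] at h3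
  refine (le_abs_self _).trans (h3.le.trans ?_)
  rw [mul_comm]
  have hx' : 0 < x ^ c := Real.rpow_pos_of_pos hx c
  have hc1 : (c : ℂ) ≠ 1 := by exact_mod_cast hc.ne'
  rw [logDeriv_riemannZeta hc1 (riemannZeta_ne_zero_of_one_lt_re (by simpa using hc))]
  have h4 : ‖(1 : ℂ) / (c - 1)‖ = 1 / (c - 1) := by
    rw [norm_div, norm_one, ← ofReal_one, ← ofReal_sub, norm_real,
      Real.norm_of_nonneg (by linarith)]
  have h5 := norm_sub_le (logDeriv riemannZeta₁ c) (1 / (c - 1))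
  rw [h4] at h5
  have h6 := norm_logDeriv_riemannZeta₁_le_near_one hc.le hc2
  gcongr
  linarith

/-! ### The truncated Perron formula for the Chebyshev function -/

theorem two_rpow_le {c : ℝ} (hc2 : c ≤ 1.01) : (2 : ℝ) ^ c ≤ 2.1 := by
  have h1 : (2 : ℝ) ^ c ≤ 2 ^ (1.01 : ℝ) := Real.rpow_le_rpow_of_exponent_le (by norm_num) hc2
  have h2 : (2 : ℝ) ^ (1.01 : ℝ) = 2 * 2 ^ (1 / 100 : ℝ) := by
    rw [show (1.01 : ℝ) = 1 + 1 / 100 by norm_num, Real.rpow_add (by norm_num), Real.rpow_one]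
  have h3 : (2 : ℝ) ^ (1 / 100 : ℝ) ≤ 1.05 := by
    have h4 : (2 : ℝ) ≤ 1.05 ^ (100 : ℕ) := by norm_num
    calc (2 : ℝ) ^ (1 / 100 : ℝ) ≤ (1.05 ^ (100 : ℕ)) ^ (1 / 100 : ℝ) :=
          Real.rpow_le_rpow (by norm_num) h4 (by norm_num)
      _ = 1.05 := by
        rw [← Real.rpow_natCast, ← Real.rpow_mul (by norm_num)]
        norm_num
  linarith

/-- The kernel at `x / n` for `n` at distance comparable with `|x - n|` from `x`. -/
theorem rpow_div_abs_log_le {c x n : ℝ} (hc : 1 ≤ c) (hc2 : c ≤ 1.01) (hx : 0 < x) (hn : 0 < n)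
    (hnx : n ≠ x) (h2 : x ≤ 2 * n) :
    (x / n) ^ c / |Real.log (x / n)| ≤ 2.1 * x / |x - n| := by
  have hy : 0 < x / n := div_pos hx hn
  rcases lt_or_gt_of_ne hnx with h | h
  · have hxn : 0 < x - n := by linarith
    have h1 : (x / n) ^ c ≤ 2.1 := by
      refine le_trans (Real.rpow_le_rpow hy.le ?_ (by linarith)) (two_rpow_le hc2)
      rw [div_le_iff₀ hn]; linarith
    have h3 : (x - n) / x ≤ |Real.log (x / n)| := by
      have h4 := Real.one_sub_inv_le_log_of_pos hy
      have h5 : 1 - (x / n)⁻¹ = (x - n) / x := by field_simp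
      rw [h5] at h4
      exact h4.trans (le_abs_self _)
    rw [abs_of_pos hxn]
    calc (x / n) ^ c / |Real.log (x / n)| ≤ 2.1 / ((x - n) / x) := by
          have : 0 < (x - n) / x := by positivity
          gcongr
      _ = 2.1 * x / (x - n) := by field_simp
  · have hxn : 0 < n - x := by linarith
    have h1 : (x / n) ^ c ≤ x / n := by
      have := Real.rpow_le_rpow_of_exponent_ge hy ((div_le_one hn).mpr h.le) hc
      rwa [Real.rpow_one] at this
    have h3 : (n - x) / n ≤ |Real.log (x / n)| := by
      have h4 := Real.log_le_sub_one_of_pos hy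
      have h5 : (n - x) / n = -(x / n - 1) := by field_simp; ring
      rw [h5, abs_of_nonpos (by have : x / n ≤ 1 := (div_le_one hn).mpr h.le
                                linarith)]
      linarith
    rw [abs_sub_comm, abs_of_pos hxn]
    calc (x / n) ^ c / |Real.log (x / n)| ≤ (x / n) / ((n - x) / n) := by
          have : 0 < (n - x) / n := by positivity
          gcongr
      _ = x / (n - x) := by field_simp
      _ ≤ 2.1 * x / (n - x) := by gcongr; linarith

theorem sum_Icc_one_div_le (N : ℕ) : ∑ k ∈ Finset.Icc 1 N, (1 : ℝ) / k ≤ 1 + Real.log N := by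
  have h := harmonic_le_one_add_log N
  rw [harmonic_eq_sum_Icc] at h
  push_cast at h
  simpa using h

/-- The truncated Perron formula for `ψ`. The three terms come from the `n` far from `x`, from the
`n` close to `x`, and from the two integers next to `x`, where the kernel is bounded trivially. -/
theorem norm_tsum_perronKernel_sub_psi_le {c H x : ℝ} (hc : 1 < c) (hc2 : c ≤ 1.01)
    (hH : 1 ≤ H) (hx : 2 ≤ x) :
    ‖∑' n : ℕ, (ArithmeticFunction.vonMangoldt n : ℂ) * perronKernel c H (x / n) -
        (Chebyshev.psi x : ℝ)‖ ≤
      x ^ c * (1 / (c - 1) + 256) / (Real.pi * H * Real.log 2) +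
        8.4 * x * (Real.log x + 2) ^ 2 / (Real.pi * H) +
        2 * ((Real.log x + 2) * (2.1 * (1 + Real.log H) / Real.pi + 1)) := by
  have hx0 : 0 < x := by linarith
  have hpi := Real.pi_pos
  have hlogH : 0 ≤ Real.log H := Real.log_nonneg hH
  have hlog2 : 0 < Real.log 2 := Real.log_pos (by norm_num)
  set N : ℕ := ⌊x⌋₊ with hN
  have hNx : (N : ℝ) ≤ x := Nat.floor_le hx0.le
  have hxN : x < N + 1 := Nat.lt_floor_add_one x
  have hN2 : 2 ≤ N := Nat.le_floor (by exact_mod_cast hx)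
  set M : ℝ := Real.log x + 2 with hM
  have hlogx : 0 ≤ Real.log x := Real.log_nonneg (by linarith)
  have hlogmul : ∀ z : ℝ, 1 ≤ z → z ≤ 3 * x → Real.log z ≤ M := by
    intro z hz1 hz
    calc Real.log z ≤ Real.log (3 * x) := Real.log_le_log (by linarith) hz
      _ = Real.log 3 + Real.log x := Real.log_mul (by norm_num) hx0.ne'
      _ ≤ M := by
        have : Real.log 3 ≤ 3 - 1 := Real.log_le_sub_one_of_pos (by norm_num)
        rw [hM]; linarith
  have hlogN : 1 + Real.log (N + 1 : ℕ) ≤ M := by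
    have h1 : ((N + 1 : ℕ) : ℝ) ≤ 2 * x := by push_cast; linarith
    have h2 : Real.log (N + 1 : ℕ) ≤ Real.log (2 * x) := Real.log_le_log (by positivity) h1
    rw [Real.log_mul (by norm_num) hx0.ne'] at h2
    have : Real.log 2 ≤ 2 - 1 := Real.log_le_sub_one_of_pos (by norm_num)
    rw [hM]; linarith
  let Λ : ℕ → ℝ := fun n => ArithmeticFunction.vonMangoldt n
  have hΛ0 : ∀ n, 0 ≤ Λ n := fun n => ArithmeticFunction.vonMangoldt_nonneg
  have hΛM : ∀ n : ℕ, (n : ℝ) ≤ 3 * x → Λ n ≤ M := by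
    intro n hn
    rcases Nat.eq_zero_or_pos n with rfl | h
    · simp [Λ, hM]; linarith
    · exact ArithmeticFunction.vonMangoldt_le_log.trans (hlogmul n (by exact_mod_cast h) hn)
  have hψ : HasSum (fun n : ℕ => (Λ n : ℂ) * (if n ≤ N then 1 else 0 : ℂ))
      ((Chebyshev.psi x : ℝ) : ℂ) := by
    have h := hasSum_sum_of_ne_finset_zero (L := SummationFilter.unconditional ℕ)
      (s := Finset.Icc 0 N)
      (f := fun n : ℕ => (Λ n : ℂ) * (if n ≤ N then 1 else 0 : ℂ)) (by
        intro n hn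
        have : ¬ n ≤ N := fun h => hn (Finset.mem_Icc.mpr ⟨Nat.zero_le n, h⟩)
        simp [this])
    convert! h using 1
    rw [Chebyshev.psi_eq_sum_Icc, ofReal_sum]
    refine Finset.sum_congr rfl fun n hn => ?_
    simp [(Finset.mem_Icc.mp hn).2, Λ]
  have hK := hasSum_vonMangoldt_mul_perronKernel (H := H) hc hx0
  have hdiff := hK.summable.hasSum.sub hψ
  -- `far` majorizes the terms with `2 ≤ x / n` or `x / n ≤ 1 / 2`, while `below` and `above` treat
  -- the other `n` on each side of `x`, and `next` the two integers `N`, `N + 1` next to `x`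
  let far : ℕ → ℝ := fun n => Λ n * (x / n) ^ c / (Real.pi * H * Real.log 2)
  let below : ℕ → ℝ := fun n => if n ∈ Finset.Ico 1 N then
    4.2 * x * M / (Real.pi * H) * (1 / (N - n : ℕ)) else 0
  let above : ℕ → ℝ := fun n => if n ∈ Finset.Ico (N + 1) (2 * N + 2) then
    4.2 * x * M / (Real.pi * H) * (1 / (n - N : ℕ)) else 0
  let next : ℕ → ℝ := fun n => if n ∈ Finset.Icc N (N + 1) then
    M * (2.1 * (1 + Real.log H) / Real.pi + 1) else 0
  have hM0 : 0 ≤ M := by rw [hM]; linarith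
  have hfar0 : ∀ n, 0 ≤ far n := fun n => by
    have := hΛ0 n
    have : 0 ≤ (x / n) ^ c := Real.rpow_nonneg (by positivity) c
    simp only [far]; positivity
  have hbelow0 : ∀ n, 0 ≤ below n := fun n => by
    simp only [below]; split_ifs <;> positivity
  have habove0 : ∀ n, 0 ≤ above n := fun n => by
    simp only [above]; split_ifs <;> positivity
  have hnext0 : ∀ n, 0 ≤ next n := fun n => by
    simp only [next]; split_ifs <;> positivity
  have hfar : HasSum far (∑' n, far n) :=
    ((summable_vonMangoldt_mul_rpow hc hx0).div_const _).hasSum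
  have hfarle : ∑' n, far n ≤ x ^ c * (1 / (c - 1) + 256) / (Real.pi * H * Real.log 2) := by
    simp only [far, tsum_div_const]
    have := tsum_vonMangoldt_mul_rpow_le hc hc2 hx0
    gcongr
  have hbelow : HasSum below (∑ n ∈ Finset.Ico 1 N, below n) :=
    hasSum_sum_of_ne_finset_zero fun n hn => if_neg hn
  have habove : HasSum above (∑ n ∈ Finset.Ico (N + 1) (2 * N + 2), above n) :=
    hasSum_sum_of_ne_finset_zero fun n hn => if_neg hn
  have hnext : HasSum next (∑ n ∈ Finset.Icc N (N + 1), next n) :=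
    hasSum_sum_of_ne_finset_zero fun n hn => if_neg hn
  have hharm : ∑ k ∈ Finset.Icc 1 (N + 1), (1 : ℝ) / k ≤ M :=
    (sum_Icc_one_div_le (N + 1)).trans hlogN
  have hbelowle : ∑ n ∈ Finset.Ico 1 N, below n ≤ 4.2 * x * M / (Real.pi * H) * M := by
    have e : ∑ n ∈ Finset.Ico 1 N, below n =
        4.2 * x * M / (Real.pi * H) * ∑ k ∈ Finset.Ico 1 N, (1 : ℝ) / k := by
      rw [Finset.mul_sum]
      refine Finset.sum_bij' (fun n _ => N - n) (fun n _ => N - n) ?_ ?_ ?_ ?_ ?_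
      · intro n hn; rw [Finset.mem_Ico] at hn ⊢; omega
      · intro n hn; rw [Finset.mem_Ico] at hn ⊢; omega
      · intro n hn; rw [Finset.mem_Ico] at hn; omega
      · intro n hn; rw [Finset.mem_Ico] at hn; omega
      · intro n hn; exact if_pos hn
    rw [e]
    refine mul_le_mul_of_nonneg_left (le_trans ?_ hharm) (by positivity)
    refine Finset.sum_le_sum_of_subset_of_nonneg ?_ fun k _ _ => by positivity
    intro k hk; rw [Finset.mem_Ico] at hk; rw [Finset.mem_Icc]; omega
  have habovele : ∑ n ∈ Finset.Ico (N + 1) (2 * N + 2), above n ≤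
      4.2 * x * M / (Real.pi * H) * M := by
    have e : ∑ n ∈ Finset.Ico (N + 1) (2 * N + 2), above n =
        4.2 * x * M / (Real.pi * H) * ∑ k ∈ Finset.Icc 1 (N + 1), (1 : ℝ) / k := by
      rw [Finset.mul_sum]
      refine Finset.sum_bij' (fun n _ => n - N) (fun n _ => n + N) ?_ ?_ ?_ ?_ ?_
      · intro n hn; rw [Finset.mem_Ico] at hn; rw [Finset.mem_Icc]; omega
      · intro n hn; rw [Finset.mem_Icc] at hn; rw [Finset.mem_Ico]; omega
      · intro n hn; rw [Finset.mem_Ico] at hn; omega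
      · intro n hn; omega
      · intro n hn; exact if_pos hn
    rw [e]
    exact mul_le_mul_of_nonneg_left hharm (by positivity)
  have hnextle : ∑ n ∈ Finset.Icc N (N + 1), next n =
      2 * (M * (2.1 * (1 + Real.log H) / Real.pi + 1)) := by
    rw [Finset.sum_congr rfl fun n hn => if_pos hn, Finset.sum_const, Nat.card_Icc,
      show N + 1 + 1 - N = 2 by omega, nsmul_eq_mul, Nat.cast_ofNat]
  have hb : ∀ n : ℕ, ‖(Λ n : ℂ) * perronKernel c H (x / n) -
      (Λ n : ℂ) * (if n ≤ N then 1 else 0 : ℂ)‖ ≤ far n + below n + above n + next n := by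
    intro n
    have h1 := hfar0 n
    have h2 := hbelow0 n
    have h3 := habove0 n
    have h4 := hnext0 n
    rcases Nat.eq_zero_or_pos n with rfl | hn
    · have hΛ : Λ 0 = 0 := ArithmeticFunction.map_zero
      rw [hΛ, ofReal_zero, zero_mul, zero_mul, sub_zero, norm_zero]
      linarith
    have hn' : (0 : ℝ) < n := by exact_mod_cast hn
    have hy : 0 < x / n := div_pos hx0 hn'
    rw [← mul_sub, norm_mul, norm_real, Real.norm_of_nonneg (hΛ0 n)]
    by_cases hnN : n ∈ Finset.Icc N (N + 1)
    · -- the two integers next to `x`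
      have hnN' := Finset.mem_Icc.mp hnN
      have a1 : (N : ℝ) ≤ n := by exact_mod_cast hnN'.1
      have a2 : (n : ℝ) ≤ N + 1 := by exact_mod_cast hnN'.2
      have a3 : (2 : ℝ) ≤ N := by exact_mod_cast hN2
      have h5 : (x / n) ^ c ≤ 2.1 := by
        refine le_trans (Real.rpow_le_rpow hy.le ?_ (by linarith)) (two_rpow_le hc2)
        rw [div_le_iff₀ hn']; linarith
      have h6 : ‖perronKernel c H (x / n) - (if n ≤ N then 1 else 0 : ℂ)‖ ≤
          2.1 * (1 + Real.log H) / Real.pi + 1 := by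
        refine (norm_sub_le _ _).trans (add_le_add ?_ ?_)
        · refine (norm_perronKernel_le hc.le hH hy).trans ?_
          gcongr
        · split_ifs <;> simp
      have h7 : next n = M * (2.1 * (1 + Real.log H) / Real.pi + 1) := if_pos hnN
      have h8 := mul_le_mul (hΛM n (by linarith)) h6 (norm_nonneg _) hM0
      linarith
    · have hnx : (n : ℝ) ≠ x ∧ (n ≤ N ↔ 1 < x / n) := by
        rw [one_lt_div hn']
        rw [Finset.mem_Icc, not_and_or, not_le, not_le] at hnN
        rcases hnN with h | h
        · have a1 : (n : ℝ) + 1 ≤ N := by exact_mod_cast h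
          exact ⟨by linarith, fun _ => by linarith, fun _ => h.le⟩
        · have a1 : (N : ℝ) + 1 + 1 ≤ n := by exact_mod_cast h
          exact ⟨by linarith, fun h' => by omega, fun h' => by linarith⟩
      have hy1 : x / n ≠ 1 := by
        rw [Ne, div_eq_one_iff_eq hn'.ne']; exact hnx.1.symm
      have hker : ‖perronKernel c H (x / n) - (if n ≤ N then 1 else 0 : ℂ)‖ ≤
          (x / n) ^ c / (Real.pi * H * |Real.log (x / n)|) := by
        by_cases h : n ≤ N
        · rw [if_pos h]
          exact norm_perronKernel_sub_one_le_of_one_lt hc.le (by linarith) (hnx.2.mp h)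
        · rw [if_neg h, sub_zero]
          refine norm_perronKernel_le_of_lt_one hc.le (by linarith) hy ?_
          exact lt_of_le_of_ne (not_lt.mp fun h' => h (hnx.2.mpr h')) hy1
      have h5 := mul_le_mul_of_nonneg_left hker (hΛ0 n)
      refine h5.trans ?_
      have hyc : 0 ≤ (x / n) ^ c := Real.rpow_nonneg hy.le c
      by_cases hlog : Real.log 2 ≤ |Real.log (x / n)|
      · have h6 : Λ n * ((x / n) ^ c / (Real.pi * H * |Real.log (x / n)|)) ≤ far n := by
          simp only [far]
          rw [mul_div_assoc]
          refine mul_le_mul_of_nonneg_left ?_ (hΛ0 n)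
          gcongr
        linarith
      · rw [not_le, abs_lt, ← Real.log_inv, Real.log_lt_log_iff (by norm_num) hy,
          Real.log_lt_log_iff hy (by norm_num), lt_div_iff₀ hn', div_lt_iff₀ hn'] at hlog
        have h6 := rpow_div_abs_log_le hc.le hc2 hx0 hn' hnx.1 hlog.2.le
        have h7 : n < 2 * N + 2 := by
          have : (n : ℝ) < 2 * N + 2 := by linarith
          exact_mod_cast this
        have hmain : ∀ k : ℕ, 0 < k → (k : ℝ) ≤ 2 * |x - n| →
            Λ n * ((x / n) ^ c / (Real.pi * H * |Real.log (x / n)|)) ≤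
              4.2 * x * M / (Real.pi * H) * (1 / k) := by
          intro k hk hkx
          have hk' : (0 : ℝ) < k := by exact_mod_cast hk
          calc Λ n * ((x / n) ^ c / (Real.pi * H * |Real.log (x / n)|))
              = Λ n * ((x / n) ^ c / |Real.log (x / n)|) / (Real.pi * H) := by
                rw [mul_comm (Real.pi * H), ← div_div, mul_div_assoc]
            _ ≤ M * (2.1 * x / (k / 2)) / (Real.pi * H) := by
                have h8 : 2.1 * x / |x - n| ≤ 2.1 * x / (k / 2) := by
                  gcongr
                  linarith
                have h9 := mul_le_mul (hΛM n (by linarith)) (h6.trans h8) (by positivity) hM0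
                gcongr
            _ = 4.2 * x * M / (Real.pi * H) * (1 / k) := by field_simp; ring
        rw [Finset.mem_Icc, not_and_or, not_le, not_le] at hnN
        rcases hnN with h | h
        · have a1 : (n : ℝ) + 1 ≤ N := by exact_mod_cast h
          have h8 : below n = _ := if_pos (Finset.mem_Ico.mpr ⟨hn, h⟩)
          have h9 := hmain (N - n) (by omega) (by
            rw [Nat.cast_sub h.le, abs_of_pos (by linarith)]
            linarith)
          linarith
        · have a1 : (N : ℝ) + 1 + 1 ≤ n := by exact_mod_cast h
          have h8 : above n = _ := if_pos (Finset.mem_Ico.mpr ⟨by omega, h7⟩)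
          have h9 := hmain (n - N) (by omega) (by
            rw [Nat.cast_sub (by omega), abs_of_neg (by linarith)]
            linarith)
          linarith
  have hmaj := ((hfar.add hbelow).add habove).add hnext
  refine (hdiff.norm_le_of_bounded hmaj hb).trans ?_
  rw [hnextle]
  have : 4.2 * x * M / (Real.pi * H) * M + 4.2 * x * M / (Real.pi * H) * M =
      8.4 * x * M ^ 2 / (Real.pi * H) := by ring
  linarith

/-! ### The explicit formula -/

/-- Moving the line of integration to `re s = -1 / 4`. -/
theorem norm_perronIntegral_sub_le {x c H B B' : ℝ} (hx : 1 < x) (hc : 1 < c) (hH : 1 ≤ H)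
    (hzero : ∀ ρ : ℂ, riemannZeta ρ = 0 → |ρ.im| ≠ H)
    (hB : ∀ σ t : ℝ, -(1 / 4) ≤ σ → σ ≤ c → |t| = H →
      ‖logDeriv riemannZeta (σ + t * I)‖ ≤ B)
    (hB' : ∀ t : ℝ, |t| ≤ H → ‖logDeriv riemannZeta ((-(1 / 4) : ℝ) + t * I)‖ ≤ B') :
    ‖1 / (2 * Real.pi) * (∫ t : ℝ in (-H)..H,
        -logDeriv riemannZeta (c + t * I) * (x : ℂ) ^ (c + t * I : ℂ) / (c + t * I : ℂ)) -
        (x - zeroSum x H - (Real.log (2 * Real.pi) : ℝ))‖ ≤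
      1 / (2 * Real.pi) * (2 * (B / H * (x ^ c / Real.log x)) +
        B' * x ^ (-(1 / 4) : ℝ) * (2 * (4 + Real.log H))) := by
  have hx0 : 0 < x := by linarith
  have hH0 : 0 < H := by linarith
  have hpi := Real.pi_pos
  have hlog : 0 < Real.log x := Real.log_pos hx
  have hB0 : 0 ≤ B :=
    (norm_nonneg _).trans (hB c H (by linarith) le_rfl (abs_of_pos hH0))
  have hB0' : 0 ≤ B' := (norm_nonneg _).trans (hB' 0 (by simpa using hH0.le))
  have h0 := rectIntegral_neg_logDeriv_riemannZeta hx0 hc hH0 hzero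
  unfold rectIntegral at h0
  have hac : -(1 / 4) ≤ c := by linarith
  have hhor : ∀ t : ℝ, |t| = H → ‖∫ σ : ℝ in (-(1 / 4))..c,
      -logDeriv riemannZeta (σ + t * I) * (x : ℂ) ^ (σ + t * I : ℂ) / (σ + t * I : ℂ)‖ ≤
        B / H * (x ^ c / Real.log x) := by
    intro t ht
    refine (norm_integral_horizontal_le (B := B / H)
      (f := fun s => -logDeriv riemannZeta s * (x : ℂ) ^ s / s) hx0 hx.ne' hac
      fun σ hσ => ?_).trans ?_
    · have h1 := norm_cpow_div_horizontal_le (y := x) (t := t) (σ := σ) hx0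
        (by rintro rfl; simp at ht; linarith)
      rw [ht] at h1
      rw [mul_div_assoc, norm_mul, norm_neg]
      calc _ ≤ B * (1 / H * x ^ σ) :=
            mul_le_mul (hB σ t hσ.1.le hσ.2 ht) h1 (norm_nonneg _) hB0
        _ = _ := by ring
    · have : 0 < x ^ (-(1 / 4) : ℝ) := Real.rpow_pos_of_pos hx0 _
      gcongr
      linarith
  have hver : ‖∫ t : ℝ in (-H)..H, -logDeriv riemannZeta ((-(1 / 4) : ℝ) + t * I) *
      (x : ℂ) ^ ((-(1 / 4) : ℝ) + t * I : ℂ) / ((-(1 / 4) : ℝ) + t * I : ℂ)‖ ≤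
        B' * x ^ (-(1 / 4) : ℝ) * (2 * (4 + Real.log H)) := by
    have hne : (-(1 / 4) : ℝ) ≠ 0 := by norm_num
    have h := integral_inv_norm_vertical_le hne hH
    rw [show 1 / |(-(1 / 4) : ℝ)| = 4 by rw [abs_neg, abs_of_pos] <;> norm_num] at h
    have hcont : Continuous fun t : ℝ => ‖((-(1 / 4) : ℝ) + t * I : ℂ)‖⁻¹ :=
      Continuous.inv₀ (by fun_prop) fun t =>
        ((abs_pos.mpr hne).trans_le (norm_add_mul_I_ge_abs_re _ t)).ne'
    have h1 := intervalIntegral.norm_integral_le_of_norm_le (a := -H) (b := H)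
      (f := fun t : ℝ => -logDeriv riemannZeta ((-(1 / 4) : ℝ) + t * I) *
        (x : ℂ) ^ ((-(1 / 4) : ℝ) + t * I : ℂ) / ((-(1 / 4) : ℝ) + t * I : ℂ))
      (g := fun t : ℝ => B' * x ^ (-(1 / 4) : ℝ) * ‖((-(1 / 4) : ℝ) + t * I : ℂ)‖⁻¹)
      (μ := MeasureTheory.volume) (by linarith)
      (Filter.Eventually.of_forall fun t ht => by
        rw [norm_div, norm_mul, norm_neg, norm_ofReal_cpow_add_mul_I hx0, div_eq_mul_inv]
        have h2 := hB' t (abs_le.mpr ⟨ht.1.le, ht.2⟩)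
        have := Real.rpow_pos_of_pos hx0 (-(1 / 4))
        gcongr)
      ((continuous_const.mul hcont).intervalIntegrable _ _)
    rw [intervalIntegral.integral_const_mul] at h1
    refine h1.trans ?_
    have := Real.rpow_pos_of_pos hx0 (-(1 / 4))
    gcongr
  have h1 := hhor (-H) (by rw [abs_neg, abs_of_pos hH0])
  have h2 := hhor H (abs_of_pos hH0)
  set X1 := ∫ σ : ℝ in (-(1 / 4))..c, -logDeriv riemannZeta (σ + (-H : ℝ) * I) *
    (x : ℂ) ^ (σ + (-H : ℝ) * I : ℂ) / (σ + (-H : ℝ) * I : ℂ)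
  set X2 := ∫ σ : ℝ in (-(1 / 4))..c, -logDeriv riemannZeta (σ + H * I) *
    (x : ℂ) ^ (σ + H * I : ℂ) / (σ + H * I : ℂ)
  set X3 := ∫ t : ℝ in (-H)..H, -logDeriv riemannZeta ((-(1 / 4) : ℝ) + t * I) *
      (x : ℂ) ^ ((-(1 / 4) : ℝ) + t * I : ℂ) / ((-(1 / 4) : ℝ) + t * I : ℂ)
  set J := ∫ t : ℝ in (-H)..H,
        -logDeriv riemannZeta (c + t * I) * (x : ℂ) ^ (c + t * I : ℂ) / (c + t * I : ℂ)
  set Y : ℂ := x - zeroSum x H - (Real.log (2 * Real.pi) : ℝ)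
  have hpi' : (Real.pi : ℂ) ≠ 0 := by exact_mod_cast hpi.ne'
  have hII : I * I = -1 := I_mul_I
  have key : 1 / (2 * Real.pi) * J - Y = 1 / (2 * Real.pi) * (I * X1 - I * X2 + X3) := by
    have h3 : J - 2 * Real.pi * Y = I * X1 - I * X2 + X3 := by
      linear_combination (-I) * h0 + (J - X3 - 2 * Real.pi * Y) * hII
    rw [← h3]
    field_simp
  have hnorm : ‖(1 / (2 * Real.pi) : ℂ)‖ = 1 / (2 * Real.pi) := by simp [abs_of_pos hpi]
  rw [key, norm_mul, hnorm]
  refine mul_le_mul_of_nonneg_left ?_ (by positivity)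
  calc ‖I * X1 - I * X2 + X3‖ ≤ ‖I * X1‖ + ‖I * X2‖ + ‖X3‖ :=
        (norm_add_le _ _).trans (by gcongr; exact norm_sub_le _ _)
    _ = ‖X1‖ + ‖X2‖ + ‖X3‖ := by simp
    _ ≤ _ := by linarith

/-- The bound for `ζ'/ζ` inherited from `norm_logDeriv_riemannZeta₁_le`, away from the pole. -/
theorem norm_logDeriv_riemannZeta_le {σ t δ : ℝ} (hσ : -(1 / 4) ≤ σ) (hσ2 : σ ≤ 2)
    (hδ : 0 < δ) (hz : ∀ ρ : ℂ, riemannZeta ρ = 0 → ρ.re ∈ Set.Ioo (0 : ℝ) 1 →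
      δ ≤ ‖(σ + t * I : ℂ) - ρ‖) (h1 : 1 ≤ ‖(σ + t * I : ℂ) - 1‖) :
    ‖logDeriv riemannZeta (σ + t * I)‖ ≤ (55 / δ + 1800) * Real.log (|t| + 6) + 1 := by
  have hne1 : (σ + t * I : ℂ) ≠ 1 := by
    intro h; rw [h] at h1; norm_num at h1
  have hne0 : riemannZeta (σ + t * I) ≠ 0 := by
    intro h0
    have := hz _ h0 (re_mem_Ioo_of_riemannZeta_eq_zero h0 (Or.inr (by simp; linarith)))
    simp at this
    linarith
  rw [logDeriv_riemannZeta hne1 hne0]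
  refine (norm_sub_le _ _).trans (add_le_add (norm_logDeriv_riemannZeta₁_le hσ hσ2 hδ hz) ?_)
  rw [norm_div, norm_one]
  exact (div_le_one (by linarith)).mpr h1

/-- On the line `re s = -1 / 4` all nontrivial zeros are at distance at least `1 / 4`. -/
theorem norm_logDeriv_riemannZeta_left_le {t H : ℝ} (ht : |t| ≤ H) :
    ‖logDeriv riemannZeta ((-(1 / 4) : ℝ) + t * I)‖ ≤ 2020 * Real.log (H + 6) + 1 := by
  have h0 := abs_nonneg t
  refine (norm_logDeriv_riemannZeta_le (δ := 1 / 4) le_rfl (by norm_num) (by norm_num)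
    (fun ρ _ hρ => ?_) ?_).trans ?_
  · refine le_trans ?_ (abs_re_le_norm _)
    simp only [sub_re, add_re, mul_re, ofReal_re, ofReal_im, I_re, I_im]
    rw [abs_of_neg] <;> linarith [hρ.1]
  · refine le_trans ?_ (abs_re_le_norm _)
    simp only [sub_re, add_re, mul_re, ofReal_re, ofReal_im, I_re, I_im, one_re]
    rw [abs_of_neg] <;> linarith
  · have : Real.log (|t| + 6) ≤ Real.log (H + 6) := Real.log_le_log (by linarith) (by linarith)
    norm_num
    linarith

/-- On the horizontal sides the distance to the zeros is bounded below by `IsAssociate.gap`, on the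
lower one because the zeros are symmetric about the real axis. -/
theorem norm_logDeriv_riemannZeta_associate_le {T H σ t : ℝ} (hT : 4 ≤ T)
    (h : IsAssociate T 1.155 H) (hσ : -(1 / 4) ≤ σ) (hσ2 : σ ≤ 2) (ht : |t| = H) :
    ‖logDeriv riemannZeta (σ + t * I)‖ ≤
      (55 * (55 * Real.log (T + 6) + 1) / 1.155 + 1800) * Real.log (H + 6) + 1 := by
  obtain ⟨hTH, hgap⟩ := h.gap (by linarith)
  have hH : 1 ≤ H := by linarith [(abs_le.mp hTH).1]
  have hlog : 0 ≤ Real.log (T + 6) := Real.log_nonneg (by linarith)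
  have hδ : 0 < 1.155 / (55 * Real.log (T + 6) + 1) := by positivity
  refine (norm_logDeriv_riemannZeta_le hσ hσ2 hδ (fun ρ hρ _ => ?_) ?_).trans (le_of_eq ?_)
  · refine le_trans ?_ (abs_im_le_norm _)
    have him : ((σ + t * I : ℂ) - ρ).im = t - ρ.im := by simp
    rw [him]
    rcases abs_choice t with h1 | h1
    · rw [← h1, ht]
      exact hgap ρ hρ
    · have h2 := hgap (conj ρ) (by rw [riemannZeta_conj, hρ, map_zero])
      rw [conj_im, sub_neg_eq_add] at h2
      rwa [show t - ρ.im = -(H + ρ.im) by rw [← ht, h1]; ring, abs_neg]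
  · refine le_trans ?_ (abs_im_le_norm _)
    simpa [ht] using hH
  · rw [ht, div_div_eq_mul_div]

theorem abs_im_ne_of_isAssociate {T H : ℝ} (hT : 4 ≤ T) (h : IsAssociate T 1.155 H) {ρ : ℂ}
    (hρ : riemannZeta ρ = 0) : |ρ.im| ≠ H := by
  intro hH
  obtain ⟨-, hgap⟩ := h.gap (by linarith)
  have hlog : 0 ≤ Real.log (T + 6) := Real.log_nonneg (by linarith)
  have hδ : 0 < 1.155 / (55 * Real.log (T + 6) + 1) := by positivity
  rcases abs_choice ρ.im with h1 | h1
  · have h2 := hgap ρ hρ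
    rw [← hH, h1, sub_self, abs_zero] at h2
    linarith
  · have h2 := hgap (conj ρ) (by rw [riemannZeta_conj, hρ, map_zero])
    rw [← hH, h1, conj_im, sub_self, abs_zero] at h2
    linarith

set_option maxHeartbeats 1600000 in
/-- Numerical comparison of all error contributions with `(x / T) log² x`, for `L = log x`. -/
theorem error_terms_le {x L T H B B' u v : ℝ} (hx0 : 0 < x) (hL : L = Real.log x)
    (hL7 : (10 ^ 7 : ℝ) ≤ L) (hT0 : 0 < T) (hTx : T ≤ x) (hH0 : 0 < H)
    (hxH : x / H ≤ 1.001 * (x / T)) (hlogH1 : Real.log H ≤ L + 1) (hlogH2 : 0 ≤ Real.log H)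
    (hu0 : 0 ≤ u) (hu : u ≤ L + 2) (hv0 : 0 ≤ v) (hv : v ≤ L + 2)
    (hBdef : B = (55 * (55 * u + 1) / 1.155 + 1800) * v + 1) (hBdef' : B' = 2020 * v + 1) :
    Real.log (2 * Real.pi) +
        1 / (2 * Real.pi) * (2 * (B / H * (x * Real.exp 1 / L)) +
          B' * x ^ (-(1 / 4) : ℝ) * (2 * (4 + Real.log H))) +
        (x * Real.exp 1 * (L + 256) / (Real.pi * H * Real.log 2) +
          8.4 * x * (L + 2) ^ 2 / (Real.pi * H) +
          2 * ((L + 2) * (2.1 * (1 + Real.log H) / Real.pi + 1))) ≤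
      5.26 * (x * L ^ 2 / T) := by
  have hpi3 := Real.pi_gt_d2
  have hpi4 := Real.pi_lt_d2
  have he := Real.exp_one_lt_d9
  have hlog2 := Real.log_two_gt_d9
  have hL0 : 0 < L := by linarith
  set r := x / T with hr
  have hr1 : 1 ≤ r := (one_le_div hT0).mpr hTx
  have hxH0 : 0 < x / H := by positivity
  -- each contribution is compared with `r L ^ 2`
  have hlog2pi : Real.log (2 * Real.pi) ≤ 0.01 * (r * L ^ 2) := by
    have h1 : Real.log (2 * Real.pi) ≤ 2 * Real.pi - 1 :=
      Real.log_le_sub_one_of_pos (by linarith)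
    have h2 : (100 : ℝ) * 100 ≤ L * L := by gcongr <;> linarith
    have h3 : 1 * (L * L) ≤ r * (L * L) := by gcongr
    linarith
  have hM : L + 2 ≤ 1.001 * L := by linarith
  have hB : B ≤ 2700 * L ^ 2 := by
    have h1 : (55 * (55 * u + 1) / 1.155 + 1800) ≤ 2630 * L := by
      norm_num
      linarith
    have h2 := mul_le_mul h1 (hv.trans hM) hv0 (by positivity)
    have h3 : (100 : ℝ) * 100 ≤ L * L := by gcongr <;> linarith
    rw [hBdef]
    linarith
  have hbot : 1 / (2 * Real.pi) * (2 * (B / H * (x * Real.exp 1 / L))) ≤ 0.01 * (r * L ^ 2) := by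
    have e1 : 1 / (2 * Real.pi) * (2 * (B / H * (x * Real.exp 1 / L))) =
        (1 / Real.pi) * (Real.exp 1) * (B / L) * (x / H) := by
      field_simp
    have h1 : 1 / Real.pi ≤ 1 / 3 := one_div_le_one_div_of_le (by norm_num) (by linarith)
    have h2 : B / L ≤ 2700 * L := by
      rw [div_le_iff₀ hL0]; linarith
    have hB0 : 0 ≤ B := by rw [hBdef]; positivity
    rw [e1]
    calc _ ≤ (1 / 3) * 3 * (2700 * L) * (1.001 * r) := by gcongr; linarith
      _ = 2702.7 * (r * L) := by ring
      _ ≤ 0.01 * (r * L * L) := by nlinarith [mul_pos (by linarith : 0 < r) hL0]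
      _ = _ := by ring
  have hleft : 1 / (2 * Real.pi) * (B' * x ^ (-(1 / 4) : ℝ) * (2 * (4 + Real.log H))) ≤
      0.01 * (r * L ^ 2) := by
    have h1 : 1 / (2 * Real.pi) ≤ 1 / 6 := one_div_le_one_div_of_le (by norm_num) (by linarith)
    have h2 : B' ≤ 2100 * L := by rw [hBdef']; linarith
    have h3 : x ^ (-(1 / 4) : ℝ) ≤ 4 / L := by
      rw [Real.rpow_neg hx0.le, Real.rpow_def_of_pos hx0, ← hL, ← one_div,
        show 4 / L = 1 / (L / 4) by rw [one_div_div]]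
      refine one_div_le_one_div_of_le (by positivity) ?_
      have := Real.add_one_le_exp (L * (1 / 4))
      linarith
    have hB0 : 0 ≤ B' := by rw [hBdef']; positivity
    have h4 : 2 * (4 + Real.log H) ≤ 3 * L := by linarith
    have hx4 : 0 < x ^ (-(1 / 4) : ℝ) := Real.rpow_pos_of_pos hx0 _
    calc _ ≤ 1 / 6 * (2100 * L * (4 / L) * (3 * L)) := by gcongr
      _ = 4200 * L := by field_simp; norm_num
      _ ≤ 0.01 * L ^ 2 := by nlinarith
      _ ≤ 0.01 * (r * L ^ 2) := by nlinarith [sq_nonneg L]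
  have hfar : x * Real.exp 1 * (L + 256) / (Real.pi * H * Real.log 2) ≤ 0.01 * (r * L ^ 2) := by
    have e1 : x * Real.exp 1 * (L + 256) / (Real.pi * H * Real.log 2) =
        Real.exp 1 * (L + 256) * (x / H) / (Real.pi * Real.log 2) := by
      field_simp
    rw [e1]
    calc _ ≤ 3 * (2 * L) * (1.001 * r) / (3 * (1 / 2)) := by gcongr <;> linarith
      _ = 4.004 * (r * L) := by ring
      _ ≤ 0.01 * (r * L * L) := by nlinarith [mul_pos (by linarith : 0 < r) hL0]
      _ = _ := by ring
  have hnear : 8.4 * x * (L + 2) ^ 2 / (Real.pi * H) ≤ 2.71 * (r * L ^ 2) := by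
    have e1 : 8.4 * x * (L + 2) ^ 2 / (Real.pi * H) = 8.4 * (L + 2) ^ 2 * (x / H) / Real.pi := by
      field_simp
    rw [e1]
    calc _ ≤ 8.4 * (1.001 * L) ^ 2 * (1.001 * r) / 3.14 := by gcongr
      _ = 8.4 * 1.001 ^ 3 / 3.14 * (r * L ^ 2) := by ring
      _ ≤ _ := by
        have : 0 ≤ r * L ^ 2 := by positivity
        gcongr
        norm_num
  have hnext : 2 * ((L + 2) * (2.1 * (1 + Real.log H) / Real.pi + 1)) ≤ 1.4 * (r * L ^ 2) := by
    have h1 : 2.1 * (1 + Real.log H) / Real.pi + 1 ≤ 0.68 * L := by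
      have h2 : 2.1 * (1 + Real.log H) / Real.pi ≤ 2.1 * (1.001 * L) / 3.14 := by
        gcongr
        linarith
      have h3 : 2.1 * (1.001 * L) / 3.14 + 1 ≤ 0.68 * L := by
        rw [div_add_one (by norm_num), div_le_iff₀ (by norm_num)]
        linarith
      linarith
    calc _ ≤ 2 * (1.001 * L * (0.68 * L)) := by gcongr
      _ = 1.36136 * L ^ 2 := by ring
      _ ≤ 1.4 * (r * L ^ 2) := by nlinarith [sq_nonneg L]
  have e2 : x * L ^ 2 / T = r * L ^ 2 := by rw [hr]; ring
  rw [e2, mul_add (1 / (2 * Real.pi))]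
  have hrL : 0 ≤ r * L ^ 2 := by positivity
  linarith

theorem lemma9p1 (x T Tu : ℝ) (hx : Real.exp (Real.exp 15) ≤ x)
    (hT : Real.exp (Real.exp 18) ≤ T) (hTx : T ≤ x) (hTu : IsAssociate T 1.155 Tu) :
    ∃ E : ℝ, ((Chebyshev.psi x : ℝ) : ℂ) = (x : ℂ) - zeroSum x Tu + (E : ℂ) ∧
      |E| ≤ 5.26 * (x * Real.log x ^ 2 / T)
        + 33.488 * (x * Real.log T ^ 2 / (T * Real.log x))
        + 3 * (Real.log T ^ 2 / x) := by
  have hpi3 := Real.pi_gt_d2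
  have hpi4 := Real.pi_lt_d2
  have he := Real.exp_one_lt_d9
  have hlog2 := Real.log_two_gt_d9
  have h18 : (10 ^ 7 : ℝ) ≤ Real.exp 18 := by
    have h1 : (2.7 : ℝ) ≤ Real.exp 1 := by linarith [Real.exp_one_gt_d9]
    calc (10 ^ 7 : ℝ) ≤ 2.7 ^ 18 := by norm_num
      _ ≤ Real.exp 1 ^ 18 := by gcongr
      _ = Real.exp 18 := by rw [← Real.exp_nat_mul]; norm_num
  have hT7 : (10 ^ 7 : ℝ) ≤ T := by
    have := Real.add_one_le_exp (Real.exp 18)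
    linarith
  have hT0 : 0 < T := by linarith
  have hx0 : 0 < x := by linarith
  set L := Real.log x with hL
  have hL7 : (10 ^ 7 : ℝ) ≤ L := by
    have h1 : Real.exp 18 ≤ Real.log T := (Real.le_log_iff_exp_le hT0).mpr hT
    have h2 : Real.log T ≤ L := Real.log_le_log hT0 hTx
    linarith
  have hL0 : 0 < L := by linarith
  obtain ⟨hTH, -⟩ := hTu.gap (by linarith)
  set H := Tu
  have hH1 : T - 1.155 ≤ H := by linarith [(abs_le.mp hTH).1]
  have hH2 : H ≤ T + 1.155 := by linarith [(abs_le.mp hTH).2]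
  have hH0 : 0 < H := by linarith
  have hlog3 : ∀ z : ℝ, 0 < z → z ≤ 3 * x → Real.log z ≤ L + 2 := by
    intro z hz0 hz
    calc Real.log z ≤ Real.log (3 * x) := Real.log_le_log hz0 hz
      _ = Real.log 3 + L := Real.log_mul (by norm_num) hx0.ne'
      _ ≤ L + 2 := by
        have : Real.log 3 ≤ 3 - 1 := Real.log_le_sub_one_of_pos (by norm_num)
        linarith
  have hlogT : Real.log (T + 6) ≤ L + 2 := hlog3 _ (by linarith) (by linarith)
  have hlogH : Real.log (H + 6) ≤ L + 2 := hlog3 _ (by linarith) (by linarith)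
  have hlogT0 : 0 ≤ Real.log (T + 6) := Real.log_nonneg (by linarith)
  have hlogH0 : 0 ≤ Real.log (H + 6) := Real.log_nonneg (by linarith)
  have hlogH1 : Real.log H ≤ L + 1 := by
    calc Real.log H ≤ Real.log (2 * x) := Real.log_le_log hH0 (by linarith)
      _ = Real.log 2 + L := Real.log_mul (by norm_num) hx0.ne'
      _ ≤ L + 1 := by linarith [Real.log_two_lt_d9]
  have hlogH2 : 0 ≤ Real.log H := Real.log_nonneg (by linarith)
  -- the abscissa for which `x ^ c = e x`
  set c := 1 + 1 / L with hc
  have hc1 : 1 < c := by rw [hc]; linarith [one_div_pos.mpr hL0]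
  have hc2 : c ≤ 1.01 := by
    have : 1 / L ≤ 1 / 10 ^ 7 := one_div_le_one_div_of_le (by norm_num) hL7
    rw [hc]; norm_num at this ⊢; linarith
  have hxc : x ^ c = x * Real.exp 1 := by
    rw [hc, Real.rpow_add hx0, Real.rpow_one, Real.rpow_def_of_pos hx0, ← hL,
      mul_one_div_cancel hL0.ne']
  have hcinv : 1 / (c - 1) = L := by rw [hc]; simp
  set r := x / T with hr
  have hr1 : 1 ≤ r := (one_le_div hT0).mpr hTx
  have hxH : x / H ≤ 1.001 * r := by
    rw [hr, ← mul_div_assoc, div_le_div_iff₀ hH0 hT0]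
    nlinarith
  have hxH0 : 0 < x / H := by positivity
  set B := (55 * (55 * Real.log (T + 6) + 1) / 1.155 + 1800) * Real.log (H + 6) + 1 with hBdef
  set B' := 2020 * Real.log (H + 6) + 1 with hBdef'
  have hcontour := norm_perronIntegral_sub_le (x := x) (c := c) (H := H) (B := B) (B' := B')
    (by linarith) hc1 (by linarith) (fun ρ hρ => abs_im_ne_of_isAssociate (by linarith) hTu hρ)
    (fun σ t hσ hσ2 ht => norm_logDeriv_riemannZeta_associate_le (by linarith) hTu hσ
      (by linarith) ht)
    (fun t ht => norm_logDeriv_riemannZeta_left_le ht)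
  have hperron := norm_tsum_perronKernel_sub_psi_le (x := x) (c := c) (H := H) hc1 hc2
    (by linarith) (by linarith)
  rw [(hasSum_vonMangoldt_mul_perronKernel (H := H) hc1 hx0).tsum_eq] at hperron
  set P : ℂ := 1 / (2 * Real.pi) * ∫ t : ℝ in (-H)..H,
        -logDeriv riemannZeta (c + t * I) * (x : ℂ) ^ (c + t * I : ℂ) / (c + t * I : ℂ)
  rw [← hL, hxc, hcinv] at hperron
  rw [← hL, hxc] at hcontour
  have hZ := conj_zeroSum hx0 H
  set Z := zeroSum x H
  have hZre : ((Z.re : ℝ) : ℂ) = Z := conj_eq_iff_re.mp hZ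
  -- `conj_zeroSum` makes the error a real number
  have hE : (((Chebyshev.psi x - x + Z.re : ℝ)) : ℂ) = (Chebyshev.psi x : ℝ) - x + Z := by
    push_cast
    rw [hZre]
  refine ⟨Chebyshev.psi x - x + Z.re, by rw [hE]; ring, ?_⟩
  have hEle : |Chebyshev.psi x - x + Z.re| ≤ Real.log (2 * Real.pi) +
      ‖P - (x - Z - (Real.log (2 * Real.pi) : ℝ))‖ + ‖P - (Chebyshev.psi x : ℝ)‖ := by
    rw [← Real.norm_eq_abs, ← norm_real, hE]
    have e1 : ((Chebyshev.psi x : ℝ) : ℂ) - x + Z =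
        -((Real.log (2 * Real.pi) : ℝ) : ℂ) + (P - (x - Z - (Real.log (2 * Real.pi) : ℝ))) -
          (P - (Chebyshev.psi x : ℝ)) := by ring
    rw [e1]
    refine (norm_sub_le _ _).trans (add_le_add ((norm_add_le _ _).trans (le_of_eq ?_)) le_rfl)
    rw [norm_neg, norm_real, Real.norm_of_nonneg (Real.log_nonneg (by linarith))]
  have hfinal := error_terms_le (B := B) (B' := B') hx0 hL hL7 hT0 hTx hH0 hxH hlogH1 hlogH2
    hlogT0 hlogT hlogH0 hlogH hBdef hBdef'
  have h3 : 0 ≤ 33.488 * (x * Real.log T ^ 2 / (T * L)) := by positivity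
  have h4 : 0 ≤ 3 * (Real.log T ^ 2 / x) := by positivity
  linarith
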